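/- Let $F$ be a non-archimedean local field with ring of integers $\mathcal O_F$ and residue field of order $q$. Let $K_1/F$ be an unramified quadratic field extension and $K_2/F$ a quadratic field extension with a non-trivial $F$-automorphism; let $\sigma_1,\sigma_2$ be the non-trivial automorphisms. Fix $\zeta_1\in\mathcal O_{K_1}$ with $(\zeta_1-\zeta_1^{\sigma_1})(\zeta_1+\zeta_1^{\sigma_1})\in\mathcal O_{K_1}^\times$ and $\varpi_2$ with $\mathcal O_{K_2}=\mathcal O_F[\varpi_2]$. Let $K_0\subset K_1\otimes_F K_1$ and $K_3\subset K_1\otimes_F K_2$ be the fixed rings of $\sigma_1\otimes\sigma_1$ and $\sigma_1\otimes\sigma_2$, with the involutions induced by $\sigma_1\otimes 1$ and the generators $$\zeta_0=\tfrac{\zeta_1}{\zeta_1^2-(\zeta_1^{\sigma_1})^2}\otimes\zeta_1-\tfrac{\zeta_1^{\sigma_1}}{\zeta_1^2-(\zeta_1^{\sigma_1})^2}\otimes\zeta_1^{\sigma_1},\qquad \varpi_3=\zeta_1\otimes\varpi_2+\zeta_1^{\sigma_1}\otimes\varpi_2^{\sigma_2},$$ so that $K_0\cong F\times F$ and $\zeta_0=(1,0)$.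 *Pairs.* Let $E$ be a commutative ring, $K,K'$ quadratic $E$-algebras with involutions (both written $x\mapsto x^\sigma$) and generators $\zeta,\varpi$. For a pair of $E$-algebra maps $\alpha=(\alpha_1,\alpha_2):(K,K')\to D$ put $\mathbf w=\alpha_1(\zeta)\alpha_2(\varpi)+\alpha_2(\varpi^{\sigma})\alpha_1(\zeta^{\sigma})$ and $\mathbf z=\alpha_2(\varpi)\alpha_1(\zeta)-\alpha_1(\zeta)\alpha_2(\varpi)$. A pair $\alpha:(K,K')\to\mathrm{Mat}_{2h}(F)$ over $E=F$ is regular semisimple if $F^{2h}$ is free of rank $h$ over $K$ (via $\alpha_1$), $\mathbf w$ has distinct eigenvalues over the algebraic closure as an element of the centralizer $\mathrm{Mat}_h(K)$ of $\alpha_1$, and $\mathbf z$ is invertible. *Orbital integrals.* Let $E$ be $F$ or a finite étale $F$-algebra and let $\alpha:(K,K')\to\mathrm{End}_E(V)$ be a pair, $V$ a finite free $E$-module. Let $\mathcal L_{\alpha_i}$ be the set of full $\mathcal O_E$-lattices in $V$ stable under $\alpha_i(\mathcal O_K)$ (resp. $\alpha_i(\mathcal O_{K'})$), and $T=E[\mathbf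 w]$. For the unit function $\mathbf 1$ (the characteristic function of $\mathrm{GL}(\mathcal O_E)$), $\mathbf 1(\Lambda_1,\Lambda_2)$ is $1$ if $\Lambda_1=\Lambda_2$ and $0$ otherwise, and $$\mathrm{Orb}(\mathbf 1,\alpha)=\sum_{(\Lambda_1,\Lambda_2)\in(\mathcal L_{\alpha_1}\times\mathcal L_{\alpha_2})/T^\times}\frac{\mathbf 1(\Lambda_1,\Lambda_2)}{\mathrm{vol}(\mathrm{Stab}_{T^\times}(\Lambda_1,\Lambda_2))},\qquad \mathrm{vol}(\mathcal O_T^\times)=1,$$ which is the integral over $(H_1\times H_2)/T^\times$, $H_i$ the centralizer of $\alpha_i$ in $\mathrm{GL}_E(V)$. If $K=K_0\otimes_F E$ with generator $\zeta=\zeta_0\otimes1$, then $\mathrm{Orb}(\mathbf 1,\alpha,s)$ is the same sum with each term multiplied by $$\Omega(\Lambda_1,s)=[\Lambda_-:\mathbf z\Lambda_+]^s\,(-1)^{\log_q[\Lambda_-:\mathbf z\Lambda_+]},\qquad \Lambda_+=\alpha_1(\zeta)\Lambda_1,\ \Lambda_-=\alpha_1(\zeta^\sigma)\Lambda_1,\quad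 s\in\mathbb C,$$ where $[A:B]=\#(A/A\cap B)/\#(B/A\cap B)$. *Reduced pair.* If $\alpha:(K,K')\to\mathrm{Mat}_{2h}(F)$ is a pair with $1+\mathbf z$ invertible and $L=F[\mathbf w]$, let $\alpha_{1L}:K\otimes_FL\to\mathrm{End}_L(F^{2h})$ be the $L$-linear extension of $\alpha_1$, and $\widetilde\alpha:K\otimes_FL\to\mathrm{End}_L(F^{2h})$ the $L$-algebra map with $\widetilde\alpha(\zeta)=(1+\mathbf z)^{-1}(\alpha_1(\zeta)-\alpha_1(\zeta^\sigma))+\alpha_1(\zeta^\sigma)$. For $(\alpha_{1L},\widetilde\alpha)$ both copies of $K\otimes_FL$ carry the generator $\zeta\otimes1$. When $\alpha$ is regular semisimple, $L$ is étale of degree $h$ over $F$ and $F^{2h}$ is free of rank $2$ over $L$. **Theorem.** Let $\beta:(K_0,K_3)\to\mathrm{Mat}_{2h}(F)$ and $\alpha:(K_1,K_2)\to\mathrm{Mat}_{2h}(F)$ be regular semisimple pairs such that $\mathcal O_F[\mathbf w_\beta]=\mathcal O_{F[\mathbf w_\beta]}$ and $\mathcal O_F[\mathbf w_\alpha]=\mathcal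 O_{F[\mathbf w_\alpha]}$, and such that $1-\mathbf z_\beta$ and $1-\mathbf z_\alpha$ are each a unit in some maximal order of $\mathrm{Mat}_{2h}(F)$. Then $$\mathrm{Orb}(\mathbf 1,(\beta_1,\beta_2),s)=\mathrm{Orb}(\mathbf 1,(\beta_{1L},\widetilde\beta),s)\quad\text{for all }s\in\mathbb C,\qquad \mathrm{Orb}(\mathbf 1,(\alpha_1,\alpha_2))=\mathrm{Orb}(\mathbf 1,(\alpha_{1L},\widetilde\alpha)),$$ the right-hand sides being formed over $L=F[\mathbf w_\beta]$ and $L=F[\mathbf w_\alpha]$ respectively. -/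

import Mathlib

open scoped TensorProduct
open ValuativeRel

noncomputable section

/-- A quadratic `F`-algebra with its involution and a chosen generator: a commutative `F`-algebra
`K`, an involution `σ` of `K` with fixed ring `F`, and an element `gen` with
`K = F + F · gen`. -/
structure QuadAlg (F K : Type*) [CommRing F] [CommRing K] [Algebra F K] where
  σ : K ≃ₐ[F] K
  gen : K
  σ_σ : ∀ x, σ (σ x) = x
  fixed : ∀ x, σ x = x → ∃ r, algebraMap F K r = x
  span : ∀ x, ∃ r s : F, x = algebraMap F K r + s • gen

namespace QuadAlg

section Basic
variable {F K : Type*} [CommRing F] [CommRing K] [Algebra F K] (S : QuadAlg F K)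

/-- The condition `(ζ - σ ζ)(ζ + σ ζ) ∈ Kˣ` on the generator `ζ`. -/
def GenUnit : Prop := IsUnit ((S.gen - S.σ S.gen) * (S.gen + S.σ S.gen))

theorem exists_trace (x : K) : ∃ t, algebraMap F K t = x + S.σ x :=
  S.fixed _ (by rw [map_add, S.σ_σ, add_comm])

theorem exists_norm (x : K) : ∃ n, algebraMap F K n = x * S.σ x :=
  S.fixed _ (by rw [map_mul, S.σ_σ, mul_comm])

theorem span_of_isUnit (σ : K ≃ₐ[F] K) (g : K) (hσ : ∀ x, σ (σ x) = x)
    (hf : ∀ x, σ x = x → ∃ r, algebraMap F K r = x) (hu : IsUnit (g - σ g)) (x : K) :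
    ∃ r s : F, x = algebraMap F K r + s • g := by
  obtain ⟨u, hu⟩ := hu
  have hσu : σ (u : K) = - u := by rw [hu, map_sub, hσ]; ring
  have hσv : σ ((u⁻¹ : Kˣ) : K) = -((u⁻¹ : Kˣ) : K) := by
    have h1 : σ (u : K) * σ ((u⁻¹ : Kˣ) : K) = 1 := by rw [← map_mul]; simp
    rw [hσu] at h1
    have h2 : ((u⁻¹ : Kˣ) : K) * u = 1 := by simp
    linear_combination (-((u⁻¹ : Kˣ) : K)) * h1 - (σ ((u⁻¹ : Kˣ) : K)) * h2
  obtain ⟨s, hs⟩ := hf ((x - σ x) * ((u⁻¹ : Kˣ) : K)) (by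
    rw [map_mul, map_sub, hσ, hσv]; ring)
  have h2 : ((u⁻¹ : Kˣ) : K) * u = 1 := by simp
  obtain ⟨r, hr⟩ := hf (x - algebraMap F K s * g) (by
    rw [map_sub, map_mul, AlgEquiv.commutes]
    have : algebraMap F K s * (g - σ g) = x - σ x := by rw [hs, ← hu, mul_assoc, h2, mul_one]
    linear_combination this)
  exact ⟨r, s, by rw [hr, Algebra.smul_def]; ring⟩

end Basic

section Descent
variable {F K₁ K₂ : Type*} [Field F] [Field K₁] [Field K₂] [Algebra F K₁] [Algebra F K₂]
  (S₁ : QuadAlg F K₁) (S₂ : QuadAlg F K₂)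

/-- The subalgebra of `K₁ ⊗ K₂` fixed by `σ₁ ⊗ σ₂`. For `(K₁, K₂)` it is `K₃`, and for
`(K₁, K₁)` it is `K₀` (which is isomorphic to `F × F` with the swap). -/
def fixedSub : Subalgebra F (K₁ ⊗[F] K₂) :=
  AlgHom.equalizer
    (Algebra.TensorProduct.map (S₁.σ : K₁ →ₐ[F] K₁) (S₂.σ : K₂ →ₐ[F] K₂))
    (AlgHom.id F (K₁ ⊗[F] K₂))

/-- The map `σ₁ ⊗ 1` on `K₁ ⊗ K₂`. -/
def leftHom : K₁ ⊗[F] K₂ →ₐ[F] K₁ ⊗[F] K₂ :=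
  Algebra.TensorProduct.map (S₁.σ : K₁ →ₐ[F] K₁) (AlgHom.id F K₂)

theorem leftHom_leftHom (x : K₁ ⊗[F] K₂) : S₁.leftHom (K₂ := K₂) (S₁.leftHom x) = x := by
  have : (S₁.leftHom (K₂ := K₂)).comp S₁.leftHom = AlgHom.id F _ := by
    ext x <;> simp [leftHom, S₁.σ_σ]
  exact DFunLike.congr_fun this x

theorem map_leftHom (x : K₁ ⊗[F] K₂) :
    Algebra.TensorProduct.map (S₁.σ : K₁ →ₐ[F] K₁) (S₂.σ : K₂ →ₐ[F] K₂) (S₁.leftHom x) =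
      S₁.leftHom (Algebra.TensorProduct.map (S₁.σ : K₁ →ₐ[F] K₁) (S₂.σ : K₂ →ₐ[F] K₂) x) := by
  have : (Algebra.TensorProduct.map (S₁.σ : K₁ →ₐ[F] K₁) (S₂.σ : K₂ →ₐ[F] K₂)).comp S₁.leftHom =
     (S₁.leftHom).comp
       (Algebra.TensorProduct.map (S₁.σ : K₁ →ₐ[F] K₁) (S₂.σ : K₂ →ₐ[F] K₂)) := by
    ext x <;> simp [leftHom]
  exact DFunLike.congr_fun this x

/-- The restriction of `σ₁ ⊗ 1` to the subalgebra fixed by `σ₁ ⊗ σ₂`. -/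
def fixedHom : S₁.fixedSub S₂ →ₐ[F] S₁.fixedSub S₂ :=
  (S₁.leftHom.comp (S₁.fixedSub S₂).val).codRestrict (S₁.fixedSub S₂) (fun x => by
    have hx := x.2
    simp only [fixedSub, AlgHom.mem_equalizer, AlgHom.id_apply] at hx ⊢
    change _ = S₁.leftHom (x : K₁ ⊗[F] K₂)
    change Algebra.TensorProduct.map _ _ (S₁.leftHom (x : K₁ ⊗[F] K₂)) = _
    rw [map_leftHom, hx])

theorem fixedHom_fixedHom (x) : S₁.fixedHom S₂ (S₁.fixedHom S₂ x) = x :=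
  Subtype.ext (S₁.leftHom_leftHom (x : K₁ ⊗[F] K₂))

/-- The involution of the subalgebra fixed by `σ₁ ⊗ σ₂`: the restriction of `σ₁ ⊗ 1`, which
on this subalgebra is also that of `1 ⊗ σ₂`. -/
def fixedEquiv : S₁.fixedSub S₂ ≃ₐ[F] S₁.fixedSub S₂ :=
  AlgEquiv.ofAlgHom (S₁.fixedHom S₂) (S₁.fixedHom S₂)
    (AlgHom.ext (S₁.fixedHom_fixedHom S₂)) (AlgHom.ext (S₁.fixedHom_fixedHom S₂))

theorem tensor_span (x : K₁ ⊗[F] K₂) : ∃ y y' : K₂, x = 1 ⊗ₜ y + S₁.gen ⊗ₜ y' := by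
  induction x using TensorProduct.induction_on with
  | zero => exact ⟨0, 0, by simp⟩
  | tmul a b =>
    obtain ⟨r, s, rfl⟩ := S₁.span a
    refine ⟨r • b, s • b, ?_⟩
    rw [TensorProduct.add_tmul, Algebra.algebraMap_eq_smul_one, TensorProduct.smul_tmul,
      TensorProduct.smul_tmul]
  | add x y hx hy =>
    obtain ⟨a, a', rfl⟩ := hx
    obtain ⟨b, b', rfl⟩ := hy
    exact ⟨a + b, a' + b', by simp only [TensorProduct.tmul_add]; abel⟩

variable {S₁}

theorem gen_sub_ne_zero (h : S₁.GenUnit) : S₁.gen - S₁.σ S₁.gen ≠ 0 :=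
  left_ne_zero_of_mul h.ne_zero

theorem gen_add_ne_zero (h : S₁.GenUnit) : S₁.gen + S₁.σ S₁.gen ≠ 0 :=
  right_ne_zero_of_mul h.ne_zero

theorem fixedEquiv_fixed (h : S₁.GenUnit) (x : S₁.fixedSub S₂) (hx : S₁.fixedEquiv S₂ x = x) :
    ∃ r, algebraMap F (S₁.fixedSub S₂) r = x := by
  obtain ⟨x, hxm⟩ := x
  have hx1 : S₁.leftHom x = x := congrArg Subtype.val hx
  have hx2 : Algebra.TensorProduct.map (S₁.σ : K₁ →ₐ[F] K₁) (S₂.σ : K₂ →ₐ[F] K₂) x = x := hxm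
  obtain ⟨y, y', rfl⟩ := S₁.tensor_span x
  have hd := gen_sub_ne_zero h
  have h0 : (S₁.gen - S₁.σ S₁.gen) ⊗ₜ[F] y' = 0 := by
    simp only [leftHom, map_add, Algebra.TensorProduct.map_tmul, AlgHom.id_apply, map_one] at hx1
    rw [TensorProduct.sub_tmul, sub_eq_zero]
    exact (add_left_cancel hx1).symm
  have h1 : (1 : K₁) ⊗ₜ[F] y' = 0 := by
    have := congrArg (fun t => ((S₁.gen - S₁.σ S₁.gen)⁻¹ ⊗ₜ[F] (1 : K₂)) * t) h0
    simpa [hd] using this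
  have inj : Function.Injective (fun y : K₂ => (1 : K₁) ⊗ₜ[F] y) :=
    Algebra.TensorProduct.includeRight_injective (A := K₁) (B := K₂) (algebraMap F K₁).injective
  have hy' : y' = 0 := inj (by simpa using h1)
  subst hy'
  obtain ⟨r, rfl⟩ := S₂.fixed y (inj (by simpa using hx2))
  refine ⟨r, Subtype.ext ?_⟩
  change algebraMap F (K₁ ⊗[F] K₂) r = _
  simp [Algebra.algebraMap_eq_smul_one, Algebra.TensorProduct.one_def]

variable (S₁)

/-- The intermediate generator `ϖ₃ = ζ₁ ⊗ ϖ₂ + σ ζ₁ ⊗ σ ϖ₂` of `K₃`. -/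
def gen₃ : S₁.fixedSub S₂ :=
  ⟨S₁.gen ⊗ₜ S₂.gen + S₁.σ S₁.gen ⊗ₜ S₂.σ S₂.gen, by
    simp only [fixedSub, AlgHom.mem_equalizer, map_add, Algebra.TensorProduct.map_tmul,
      AlgHom.id_apply, AlgEquiv.coe_toAlgHom, S₁.σ_σ, S₂.σ_σ]
    rw [add_comm]⟩

/-- The generator `ζ₀` of `K₀`; under `K₀ ≃ F × F` it is the idempotent `(1, 0)`. -/
def gen₀ : S₁.fixedSub S₁ :=
  ⟨(S₁.gen / (S₁.gen ^ 2 - S₁.σ S₁.gen ^ 2)) ⊗ₜ S₁.gen -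
    (S₁.σ S₁.gen / (S₁.gen ^ 2 - S₁.σ S₁.gen ^ 2)) ⊗ₜ S₁.σ S₁.gen, by
    simp only [fixedSub, AlgHom.mem_equalizer, map_sub, Algebra.TensorProduct.map_tmul,
      AlgHom.id_apply, AlgEquiv.coe_toAlgHom, S₁.σ_σ, map_div₀, map_pow]
    rw [← neg_sub (S₁.gen ^ 2), div_neg, div_neg, TensorProduct.neg_tmul, TensorProduct.neg_tmul]
    abel⟩

variable {S₁}

theorem gen₃_span (h : S₁.GenUnit) (x : S₁.fixedSub S₂) :
    ∃ r s : F, x = algebraMap F (S₁.fixedSub S₂) r + s • S₁.gen₃ S₂ := by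
  obtain ⟨x, hxm⟩ := x
  have hx2 : Algebra.TensorProduct.map (S₁.σ : K₁ →ₐ[F] K₁) (S₂.σ : K₂ →ₐ[F] K₂) x = x := hxm
  have hd := gen_sub_ne_zero h
  have ht := gen_add_ne_zero h
  have hts : S₁.σ (S₁.gen + S₁.σ S₁.gen) = S₁.gen + S₁.σ S₁.gen := by
    rw [map_add, S₁.σ_σ, add_comm]
  set g₃ : K₁ ⊗[F] K₂ := S₁.gen ⊗ₜ S₂.gen + S₁.σ S₁.gen ⊗ₜ S₂.σ S₂.gen with hg₃
  have hg₃fix : Algebra.TensorProduct.map (S₁.σ : K₁ →ₐ[F] K₁) (S₂.σ : K₂ →ₐ[F] K₂) g₃ = g₃ :=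
    (S₁.gen₃ S₂).2
  obtain ⟨t, ht'⟩ := S₂.exists_trace S₂.gen
  have hg₃' : g₃ = (S₁.gen - S₁.σ S₁.gen) ⊗ₜ S₂.gen + (t • S₁.σ S₁.gen) ⊗ₜ (1 : K₂) := by
    have : S₂.σ S₂.gen = t • 1 - S₂.gen := by
      rw [← Algebra.algebraMap_eq_smul_one, ht']; ring
    rw [hg₃, this, TensorProduct.tmul_sub, TensorProduct.sub_tmul, TensorProduct.smul_tmul]
    abel
  -- every element is `c + c' g₃` with `c, c' ∈ K₁`
  have hgen : ∀ x : K₁ ⊗[F] K₂, ∃ c c' : K₁, x = c ⊗ₜ 1 + (c' ⊗ₜ 1) * g₃ := by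
    intro x
    induction x using TensorProduct.induction_on with
    | zero => exact ⟨0, 0, by simp⟩
    | tmul a b =>
      obtain ⟨r, s, rfl⟩ := S₂.span b
      refine ⟨r • a - (s • a * (S₁.gen - S₁.σ S₁.gen)⁻¹) * (t • S₁.σ S₁.gen),
        s • a * (S₁.gen - S₁.σ S₁.gen)⁻¹, ?_⟩
      rw [hg₃', mul_add, Algebra.TensorProduct.tmul_mul_tmul, Algebra.TensorProduct.tmul_mul_tmul,
        inv_mul_cancel_right₀ hd, TensorProduct.tmul_add, TensorProduct.sub_tmul]
      simp only [mul_one, one_mul, Algebra.algebraMap_eq_smul_one, TensorProduct.tmul_smul,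
        TensorProduct.smul_tmul']
      abel
    | add x y hx hy =>
      obtain ⟨a, a', rfl⟩ := hx
      obtain ⟨b, b', rfl⟩ := hy
      exact ⟨a + b, a' + b', by simp only [TensorProduct.add_tmul]; ring⟩
  obtain ⟨c, c', hc⟩ := hgen x
  set T := S₁.gen + S₁.σ S₁.gen with hT
  obtain ⟨r, hr⟩ := S₁.exists_trace (S₁.gen / T * c)
  obtain ⟨s, hs⟩ := S₁.exists_trace (S₁.gen / T * c')
  refine ⟨r, s, Subtype.ext ?_⟩
  change x = algebraMap F (K₁ ⊗[F] K₂) r + s • g₃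
  have hx3 : x = (S₁.σ c) ⊗ₜ 1 + (S₁.σ c' ⊗ₜ 1) * g₃ := by
    rw [← hx2, hc, map_add, map_mul, hg₃fix]; simp
  have hone : (1 : K₁ ⊗[F] K₂) = (S₁.gen / T) ⊗ₜ 1 + (S₁.σ (S₁.gen / T)) ⊗ₜ 1 := by
    rw [← TensorProduct.add_tmul, map_div₀, hts, ← add_div, ← hT, div_self ht]; rfl
  have e1 : algebraMap F (K₁ ⊗[F] K₂) r = (S₁.gen / T * c) ⊗ₜ 1 +
      (S₁.σ (S₁.gen / T) * S₁.σ c) ⊗ₜ 1 := by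
    rw [← map_mul, ← TensorProduct.add_tmul, ← hr]; rfl
  have e2 : s • g₃ = ((S₁.gen / T * c') ⊗ₜ 1 +
      (S₁.σ (S₁.gen / T) * S₁.σ c') ⊗ₜ 1) * g₃ := by
    rw [← map_mul, ← TensorProduct.add_tmul, ← hs, Algebra.smul_def]; rfl
  calc x = ((S₁.gen / T) ⊗ₜ 1) * x + ((S₁.σ (S₁.gen / T)) ⊗ₜ 1) * x := by
        rw [← add_mul, ← hone, one_mul]
    _ = ((S₁.gen / T) ⊗ₜ 1) * (c ⊗ₜ 1 + (c' ⊗ₜ 1) * g₃) +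
        ((S₁.σ (S₁.gen / T)) ⊗ₜ 1) * ((S₁.σ c) ⊗ₜ 1 + (S₁.σ c' ⊗ₜ 1) * g₃) := by
        rw [← hc, ← hx3]
    _ = _ := by
        rw [e1, e2]
        simp only [mul_add, add_mul, ← mul_assoc, Algebra.TensorProduct.tmul_mul_tmul, mul_one]
        abel

theorem gen₀_sub_isUnit (h : S₁.GenUnit) : IsUnit (S₁.gen₀ - S₁.fixedEquiv S₁ S₁.gen₀) := by
  have hd := gen_sub_ne_zero h
  have ht := gen_add_ne_zero h
  have hg : S₁.gen ^ 2 - S₁.σ S₁.gen ^ 2 ≠ 0 := by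
    rw [show S₁.gen ^ 2 - S₁.σ S₁.gen ^ 2 =
      (S₁.gen - S₁.σ S₁.gen) * (S₁.gen + S₁.σ S₁.gen) by ring]
    exact h.ne_zero
  refine IsUnit.of_mul_eq_one (S₁.gen₀ - S₁.fixedEquiv S₁ S₁.gen₀) (Subtype.ext ?_)
  have key : ((S₁.gen₀ - S₁.fixedEquiv S₁ S₁.gen₀ : S₁.fixedSub S₁) : K₁ ⊗[F] K₁) =
      (S₁.gen - S₁.σ S₁.gen)⁻¹ ⊗ₜ (S₁.gen - S₁.σ S₁.gen) := by
    change ((S₁.gen / (S₁.gen ^ 2 - S₁.σ S₁.gen ^ 2)) ⊗ₜ[F] S₁.gen -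
      (S₁.σ S₁.gen / (S₁.gen ^ 2 - S₁.σ S₁.gen ^ 2)) ⊗ₜ[F] S₁.σ S₁.gen) -
      S₁.leftHom ((S₁.gen / (S₁.gen ^ 2 - S₁.σ S₁.gen ^ 2)) ⊗ₜ[F] S₁.gen -
      (S₁.σ S₁.gen / (S₁.gen ^ 2 - S₁.σ S₁.gen ^ 2)) ⊗ₜ[F] S₁.σ S₁.gen) = _
    simp only [leftHom, map_sub, Algebra.TensorProduct.map_tmul, AlgHom.id_apply,
      AlgEquiv.coe_toAlgHom, map_div₀, map_pow, S₁.σ_σ]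
    have hinv : (S₁.gen - S₁.σ S₁.gen)⁻¹ = S₁.gen / (S₁.gen ^ 2 - S₁.σ S₁.gen ^ 2) +
        S₁.σ S₁.gen / (S₁.gen ^ 2 - S₁.σ S₁.gen ^ 2) := by
      rw [← add_div, eq_div_iff hg]; field_simp; ring
    rw [hinv, ← neg_sub (S₁.gen ^ 2) (S₁.σ S₁.gen ^ 2), div_neg, div_neg]
    simp only [TensorProduct.neg_tmul, TensorProduct.tmul_sub, TensorProduct.add_tmul]
    abel
  obtain ⟨t, ht'⟩ := S₁.fixed ((S₁.gen - S₁.σ S₁.gen) ^ 2) (by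
    rw [map_pow, map_sub, S₁.σ_σ]; ring)
  change ((S₁.gen₀ - S₁.fixedEquiv S₁ S₁.gen₀ : S₁.fixedSub S₁) : K₁ ⊗[F] K₁) *
    ((S₁.gen₀ - S₁.fixedEquiv S₁ S₁.gen₀ : S₁.fixedSub S₁) : K₁ ⊗[F] K₁) = 1
  rw [key, Algebra.TensorProduct.tmul_mul_tmul, ← pow_two, ← pow_two, ← ht',
    Algebra.algebraMap_eq_smul_one, TensorProduct.tmul_smul, TensorProduct.smul_tmul',
    Algebra.smul_def, ht', ← mul_pow, mul_inv_cancel₀ hd, one_pow]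
  rfl

/-- The quadratic algebra `K₃` with generator `ϖ₃`. -/
def quad₃ (h : S₁.GenUnit) : QuadAlg F (S₁.fixedSub S₂) where
  σ := S₁.fixedEquiv S₂
  gen := S₁.gen₃ S₂
  σ_σ := S₁.fixedHom_fixedHom S₂
  fixed := fixedEquiv_fixed S₂ h
  span := gen₃_span S₂ h

/-- The quadratic algebra `K₀` with generator `ζ₀`. -/
def quad₀ (h : S₁.GenUnit) : QuadAlg F (S₁.fixedSub S₁) where
  σ := S₁.fixedEquiv S₁
  gen := S₁.gen₀
  σ_σ := S₁.fixedHom_fixedHom S₁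
  fixed := fixedEquiv_fixed S₁ h
  span := span_of_isUnit _ _ (S₁.fixedHom_fixedHom S₁) (fixedEquiv_fixed S₁ h)
    (gen₀_sub_isUnit h)

theorem quad₀_genUnit (h : S₁.GenUnit) : (quad₀ h).GenUnit := by
  have hd := gen_sub_ne_zero h
  have ht := gen_add_ne_zero h
  have hg : S₁.gen ^ 2 - S₁.σ S₁.gen ^ 2 ≠ 0 := by
    rw [show S₁.gen ^ 2 - S₁.σ S₁.gen ^ 2 =
      (S₁.gen - S₁.σ S₁.gen) * (S₁.gen + S₁.σ S₁.gen) by ring]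
    exact h.ne_zero
  have hone : S₁.gen₀ + S₁.fixedEquiv S₁ S₁.gen₀ = 1 := by
    refine Subtype.ext ?_
    change ((S₁.gen / (S₁.gen ^ 2 - S₁.σ S₁.gen ^ 2)) ⊗ₜ[F] S₁.gen -
      (S₁.σ S₁.gen / (S₁.gen ^ 2 - S₁.σ S₁.gen ^ 2)) ⊗ₜ[F] S₁.σ S₁.gen) +
      S₁.leftHom ((S₁.gen / (S₁.gen ^ 2 - S₁.σ S₁.gen ^ 2)) ⊗ₜ[F] S₁.gen -
      (S₁.σ S₁.gen / (S₁.gen ^ 2 - S₁.σ S₁.gen ^ 2)) ⊗ₜ[F] S₁.σ S₁.gen) = _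
    simp only [leftHom, map_sub, Algebra.TensorProduct.map_tmul, AlgHom.id_apply,
      AlgEquiv.coe_toAlgHom, map_div₀, map_pow, S₁.σ_σ]
    have hinv : (S₁.gen + S₁.σ S₁.gen)⁻¹ = S₁.gen / (S₁.gen ^ 2 - S₁.σ S₁.gen ^ 2) -
        S₁.σ S₁.gen / (S₁.gen ^ 2 - S₁.σ S₁.gen ^ 2) := by
      rw [← sub_div, eq_div_iff hg]; field_simp; ring
    obtain ⟨t, ht'⟩ := S₁.exists_trace S₁.gen
    have h1 : (S₁.gen + S₁.σ S₁.gen)⁻¹ ⊗ₜ[F] (S₁.gen + S₁.σ S₁.gen) = 1 := by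
      rw [← ht', Algebra.algebraMap_eq_smul_one, TensorProduct.tmul_smul,
        TensorProduct.smul_tmul', ← Algebra.algebraMap_eq_smul_one, Algebra.smul_def,
        mul_inv_cancel₀ (by rw [ht']; exact ht)]
      rfl
    rw [OneMemClass.coe_one, ← h1, hinv, ← neg_sub (S₁.gen ^ 2) (S₁.σ S₁.gen ^ 2), div_neg,
      div_neg]
    simp only [TensorProduct.neg_tmul, TensorProduct.tmul_add, TensorProduct.sub_tmul]
    abel
  exact (gen₀_sub_isUnit h).mul (by rw [show (quad₀ h).gen + (quad₀ h).σ (quad₀ h).gen = 1 from hone]; exact isUnit_one)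

end Descent
end QuadAlg

namespace QuadAlg

section BaseChange
variable {F K : Type*} [Field F] [CommRing K] [Algebra F K] (S : QuadAlg F K)
  (L : Type*) [CommRing L] [Algebra F L]

theorem GenUnit.isUnit_sub {S : QuadAlg F K} (h : S.GenUnit) : IsUnit (S.gen - S.σ S.gen) :=
  isUnit_of_mul_isUnit_left h

theorem baseChange_span (x : L ⊗[F] K) : ∃ r s : L,
    x = algebraMap L (L ⊗[F] K) r + s • (1 ⊗ₜ S.gen : L ⊗[F] K) := by
  induction x using TensorProduct.induction_on with
  | zero => exact ⟨0, 0, by simp⟩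
  | tmul a b =>
    obtain ⟨r, s, rfl⟩ := S.span b
    refine ⟨r • a, s • a, ?_⟩
    rw [Algebra.TensorProduct.algebraMap_apply, Algebra.algebraMap_self, RingHom.id_apply,
      TensorProduct.smul_tmul', smul_eq_mul, mul_one, TensorProduct.tmul_add,
      Algebra.algebraMap_eq_smul_one, TensorProduct.tmul_smul, TensorProduct.tmul_smul,
      TensorProduct.smul_tmul', TensorProduct.smul_tmul']
  | add x y hx hy =>
    obtain ⟨a, a', rfl⟩ := hx
    obtain ⟨b, b', rfl⟩ := hy
    exact ⟨a + b, a' + b', by rw [map_add, add_smul]; abel⟩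

/-- The base change `L ⊗ K` of a quadratic `F`-algebra `K` to a commutative `F`-algebra `L`, with
involution `1 ⊗ σ` and generator `1 ⊗ ζ`. -/
def baseChange (h : S.GenUnit) : QuadAlg L (L ⊗[F] K) where
  σ := Algebra.TensorProduct.congr (AlgEquiv.refl : L ≃ₐ[L] L) S.σ
  gen := 1 ⊗ₜ S.gen
  σ_σ x := by
    induction x using TensorProduct.induction_on with
    | zero => simp
    | tmul a b => simp [S.σ_σ]
    | add x y hx hy => rw [map_add, map_add, hx, hy]
  fixed x hx := by
    obtain ⟨r, s, rfl⟩ := S.baseChange_span L x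
    obtain ⟨u, hu⟩ := h.isUnit_sub
    have h0 : s • ((1 : L) ⊗ₜ[F] (S.gen - S.σ S.gen)) = 0 := by
      rw [map_add, AlgEquiv.commutes, map_smul] at hx
      rw [TensorProduct.tmul_sub, smul_sub, sub_eq_zero]
      simpa using (add_left_cancel hx).symm
    have h1 : s • (1 : L ⊗[F] K) = 0 := by
      have := congrArg (fun t => t * ((1 : L) ⊗ₜ[F] ((u⁻¹ : Kˣ) : K))) h0
      simpa [← hu, Algebra.smul_mul_assoc, Algebra.TensorProduct.one_def] using this
    refine ⟨r, ?_⟩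
    have : s • ((1 : L) ⊗ₜ[F] S.gen) = 0 := by
      rw [← one_mul ((1 : L) ⊗ₜ[F] S.gen), ← Algebra.smul_mul_assoc, h1, zero_mul]
    rw [this, add_zero]
  span := S.baseChange_span L

end BaseChange
end QuadAlg

/-- A pair of quadratic embeddings `(K, K') → A`. -/
structure QuadPair {F K K' : Type*} [CommRing F] [CommRing K] [CommRing K'] [Algebra F K]
    [Algebra F K'] (S : QuadAlg F K) (S' : QuadAlg F K') (A : Type*) [Ring A] [Algebra F A] where
  fst : K →ₐ[F] A
  snd : K' →ₐ[F] A

namespace QuadPair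

section General
variable {F K K' A : Type*} [CommRing F] [CommRing K] [CommRing K'] [Algebra F K]
    [Algebra F K'] {S : QuadAlg F K} {S' : QuadAlg F K'} [Ring A] [Algebra F A]
    (α : QuadPair S S' A)

/-- The element `w = α₁(ζ) α₂(ϖ) + α₂(σ ϖ) α₁(σ ζ)`. -/
def w : A := α.fst S.gen * α.snd S'.gen + α.snd (S'.σ S'.gen) * α.fst (S.σ S.gen)

/-- The element `z = α₂(ϖ) α₁(ζ) - α₁(ζ) α₂(ϖ)`. -/
def z : A := α.snd S'.gen * α.fst S.gen - α.fst S.gen * α.snd S'.gen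

theorem w_comm (x : K) : Commute α.w (α.fst x) := by
  obtain ⟨r, s, rfl⟩ := S.span x
  obtain ⟨t, ht⟩ := S.exists_trace S.gen
  obtain ⟨n, hn⟩ := S.exists_norm S.gen
  obtain ⟨t', ht'⟩ := S'.exists_trace S'.gen
  have hσ : α.fst (S.σ S.gen) = algebraMap F A t - α.fst S.gen := by
    rw [← AlgHom.commutes α.fst, ht, map_add]; abel
  have hσ' : α.snd (S'.σ S'.gen) = algebraMap F A t' - α.snd S'.gen := by
    rw [← AlgHom.commutes α.snd, ht', map_add]; abel
  have hsq : α.fst S.gen * α.fst S.gen = t • α.fst S.gen - n • 1 := by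
    rw [← map_mul, ← map_smul, ← map_one α.fst, ← map_smul, ← map_sub,
      ← Algebra.algebraMap_eq_smul_one, hn, Algebra.smul_def, ht]
    congr 1; ring
  have key : Commute α.w (α.fst S.gen) := by
    rw [Commute, SemiconjBy, w, hσ, hσ']
    set a := α.fst S.gen
    set b := α.snd S'.gen
    have e1 : a * a * b = t • (a * b) - n • b := by rw [hsq]; simp [sub_mul]
    have e2 : b * a * a = t • (b * a) - n • b := by rw [mul_assoc, hsq]; simp [mul_sub]
    simp only [Algebra.algebraMap_eq_smul_one, mul_add, add_mul, mul_sub, sub_mul, smul_mul_assoc,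
      mul_smul_comm, one_mul, mul_one, ← mul_assoc, e1, e2]
    module
  rw [map_add, AlgHom.commutes, map_smul]
  exact Commute.add_right (Algebra.commutes r α.w).symm (key.smul_right s)

theorem fst_mul_z (x : K) : α.fst x * α.z = α.z * α.fst (S.σ x) := by
  obtain ⟨r, s, rfl⟩ := S.span x
  obtain ⟨t, ht⟩ := S.exists_trace S.gen
  obtain ⟨n, hn⟩ := S.exists_norm S.gen
  have hσ : α.fst (S.σ S.gen) = algebraMap F A t - α.fst S.gen := by
    rw [← AlgHom.commutes α.fst, ht, map_add]; abel
  have hsq : α.fst S.gen * α.fst S.gen = t • α.fst S.gen - n • 1 := by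
    rw [← map_mul, ← map_smul, ← map_one α.fst, ← map_smul, ← map_sub,
      ← Algebra.algebraMap_eq_smul_one, hn, Algebra.smul_def, ht]
    congr 1; ring
  have key : α.fst S.gen * α.z = α.z * α.fst (S.σ S.gen) := by
    rw [z, hσ]
    set a := α.fst S.gen
    set b := α.snd S'.gen
    have e1 : a * a * b = t • (a * b) - n • b := by rw [hsq]; simp [sub_mul]
    have e2 : b * a * a = t • (b * a) - n • b := by rw [mul_assoc, hsq]; simp [mul_sub]
    simp only [Algebra.algebraMap_eq_smul_one, mul_add, add_mul, mul_sub, sub_mul, smul_mul_assoc,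
      mul_smul_comm, one_mul, mul_one, ← mul_assoc, e1, e2]
    module
  rw [map_add, map_add, AlgEquiv.commutes, map_smul, map_smul, map_add, map_smul, AlgHom.commutes,
    add_mul, mul_add, smul_mul_assoc, mul_smul_comm, key, Algebra.commutes]

theorem w_comm_z : Commute α.w α.z := by
  have h1 := α.w_comm S.gen
  have h2 : Commute α.w (α.snd S'.gen) := by
    obtain ⟨t, ht⟩ := S.exists_trace S.gen
    obtain ⟨t', ht'⟩ := S'.exists_trace S'.gen
    obtain ⟨n, hn⟩ := S'.exists_norm S'.gen
    have hσ : α.fst (S.σ S.gen) = algebraMap F A t - α.fst S.gen := by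
      rw [← AlgHom.commutes α.fst, ht, map_add]; abel
    have hσ' : α.snd (S'.σ S'.gen) = algebraMap F A t' - α.snd S'.gen := by
      rw [← AlgHom.commutes α.snd, ht', map_add]; abel
    have hsq : α.snd S'.gen * α.snd S'.gen = t' • α.snd S'.gen - n • 1 := by
      rw [← map_mul, ← map_smul, ← map_one α.snd, ← map_smul, ← map_sub,
        ← Algebra.algebraMap_eq_smul_one, hn, Algebra.smul_def, ht']
      congr 1; ring
    rw [Commute, SemiconjBy, w, hσ, hσ']
    set a := α.fst S.gen
    set b := α.snd S'.gen
    have e1 : b * b * a = t' • (b * a) - n • a := by rw [hsq]; simp [sub_mul]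
    have e2 : a * b * b = t' • (a * b) - n • a := by rw [mul_assoc, hsq]; simp [mul_sub]
    simp only [Algebra.algebraMap_eq_smul_one, mul_add, add_mul, mul_sub, sub_mul, smul_mul_assoc,
      mul_smul_comm, one_mul, mul_one, ← mul_assoc, e1, e2]
    module
  exact (h2.mul_right h1).sub_right (h1.mul_right h2)

/-- The embedding `α̃` of `K`: it is the `F`-algebra homomorphism with
`α̃(ζ) = (1 + z)⁻¹ (α₁(ζ) - α₁(σ ζ)) + α₁(σ ζ)` on the generator `ζ` of `K` (by linearity the same
formula then holds on all of `K`, see `tilde_gen` for the generator). -/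
def tilde (h : IsUnit (1 + α.z)) : K →ₐ[F] A where
  toFun x := Ring.inverse (1 + α.z) * (α.fst x - α.fst (S.σ x)) + α.fst (S.σ x)
  map_one' := by simp
  map_zero' := by simp
  map_add' x y := by simp only [map_add, mul_sub, mul_add]; abel
  commutes' r := by simp
  map_mul' x y := by
    have key : ∀ x, Ring.inverse (1 + α.z) * (α.fst x - α.fst (S.σ x)) + α.fst (S.σ x) =
        Ring.inverse (1 + α.z) * α.fst x * (1 + α.z) := by
      intro x
      have e : α.fst x * (1 + α.z) = (α.fst x - α.fst (S.σ x)) + (1 + α.z) * α.fst (S.σ x) := by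
        rw [mul_add, fst_mul_z, add_mul, mul_one, one_mul]; abel
      rw [mul_assoc, e, mul_add, Ring.inverse_mul_cancel_left _ _ h]
    rw [key, key, key, map_mul]
    simp only [mul_assoc]
    rw [Ring.mul_inverse_cancel_left _ _ h]

theorem tilde_gen (h : IsUnit (1 + α.z)) : α.tilde h S.gen =
    Ring.inverse (1 + α.z) * (α.fst S.gen - α.fst (S.σ S.gen)) + α.fst (S.σ S.gen) := rfl

theorem w_comm_tilde (h : IsUnit (1 + α.z)) (x : K) : Commute α.w (α.tilde h x) := by
  have h1 : Commute α.w (1 + α.z) := (Commute.one_right _).add_right α.w_comm_z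
  have h2 : Commute α.w (Ring.inverse (1 + α.z)) := by
    obtain ⟨u, hu⟩ := h
    rw [← hu, Ring.inverse_unit]
    exact Commute.units_inv_right (hu ▸ h1)
  exact (h2.mul_right ((α.w_comm x).sub_right (α.w_comm _))).add_right (α.w_comm _)

/-- The commutative subalgebra `L = F[w]` of `A`. -/
def L : Subalgebra F A := Algebra.adjoin F {α.w}

instance : IsMulCommutative α.L :=
  Algebra.isMulCommutative_adjoin F (by rintro _ rfl _ rfl; rfl)

instance : CommRing α.L where
  mul_comm := IsMulCommutative.is_comm.comm

theorem L_comm {x : A} (h : Commute α.w x) {l : A} (hl : l ∈ α.L) : Commute l x := by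
  induction hl using Algebra.adjoin_induction with
  | mem y hy => obtain rfl := hy; exact h
  | algebraMap r => exact Algebra.commutes r x
  | add y y' _ _ hy hy' => exact hy.add_left hy'
  | mul y y' _ _ hy hy' => exact hy.mul_left hy'
end General

end QuadPair

section Integers
variable (R E : Type*) [CommRing R] [CommRing E] [Algebra R E]

/-- `x` is integral over the ring of integers `R = O_E` of the base `E`, that is, `x ∈ O_X`. -/
def IsInt {X : Type*} [Ring X] [Algebra E X] (x : X) : Prop :=
  ((algebraMap E X).comp (algebraMap R E)).IsIntegralElem x

/-- `O_X^×` inside `X^×`. -/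
def intUnits (X : Type*) [CommRing X] [Algebra E X] : Subgroup Xˣ where
  carrier := {u | IsInt R E (u : X) ∧ IsInt R E ((u⁻¹ : Xˣ) : X)}
  one_mem' := ⟨by simpa [IsInt] using RingHom.isIntegralElem_one _,
    by simpa [IsInt] using RingHom.isIntegralElem_one _⟩
  mul_mem' {u v} hu hv := ⟨by simpa [IsInt] using RingHom.IsIntegralElem.mul _ hu.1 hv.1,
    by simpa [IsInt] using RingHom.IsIntegralElem.mul _ hv.2 hu.2⟩
  inv_mem' {u} hu := ⟨hu.2, by simpa using hu.1⟩
end Integers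

section Lattices
variable (R E : Type*) [CommRing R] [CommRing E] [Algebra R E]
  {V : Type*} [AddCommGroup V] [Module E V] [Module R V] [IsScalarTower R E V]

/-- The set `𝓛_a` of full `O_E`-lattices `Λ ⊂ V` with `a(O_K) Λ = Λ`, for an action `a` of the
quadratic `E`-algebra `K` on `V` (here `R = O_E`). -/
def stableLattices {K : Type*} [CommRing K] [Algebra E K] (a : K →ₐ[E] Module.End E V) :
    Set (Submodule R V) :=
  {Λ | Submodule.IsLattice E Λ ∧ ∀ x : K, IsInt R E x → ∀ v ∈ Λ, a x v ∈ Λ}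

/-- The generalized index `[A : B] = #(A / A ∩ B) / #(B / A ∩ B)`. -/
def latticeIndex {X : Type*} [AddCommGroup X] (A B : AddSubgroup X) : ℝ :=
  (B.relIndex A : ℝ) / (A.relIndex B : ℝ)

instance {T : Subalgebra E (Module.End E V)} : SMulCommClass Tˣ R V where
  smul_comm u r v := by
    change ((u : T) : Module.End E V) (r • v) = r • ((u : T) : Module.End E V) v
    exact LinearMap.map_smul_of_tower _ r v

end Lattices

namespace QuadPair
open scoped Pointwise
section Orb
variable (R : Type*) {E : Type*} [CommRing R] [CommRing E] [Algebra R E]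
  {V : Type*} [AddCommGroup V] [Module E V] [Module R V] [IsScalarTower R E V]
  {K K' : Type*} [CommRing K] [CommRing K'] [Algebra E K] [Algebra E K']
  {S : QuadAlg E K} {S' : QuadAlg E K'} (α : QuadPair S S' (Module.End E V))

/-- The set `𝓛_{α₁} × 𝓛_{α₂}`. -/
abbrev LatticePairs : Type _ :=
  {p : Submodule R V × Submodule R V // p.1 ∈ stableLattices R E α.fst ∧
    p.2 ∈ stableLattices R E α.snd}

/-- Two elements of `𝓛_{α₁} × 𝓛_{α₂}` are equivalent if they lie in one orbit of `E[w]ˣ`. -/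
def orbitSetoid : Setoid (α.LatticePairs R) :=
  (MulAction.orbitRel (α.L)ˣ (Submodule R V × Submodule R V)).comap Subtype.val

/-- The mass `1 / vol(Stab)` of the orbit of `p = (Λ₁, Λ₂)` under `Tˣ`, `T = E[w]`, where
`Stab ⊂ Tˣ` is the stabilizer of `p` and the Haar measure of `Tˣ` is normalized by
`vol(O_Tˣ) = 1`; it is the index `[O_Tˣ : Stab]`. -/
def orbitMass (p : Submodule R V × Submodule R V) : ℕ :=
  (MulAction.stabilizer (α.L)ˣ p).relIndex (intUnits R E α.L)

/-- The orbital integral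
`∫_{(H₁ × H₂) / Tˣ} f(h₁⁻¹ g₁⁻¹ g₂ h₂) Ω(g₁ h₁ Λ₀) dh₁ dh₂`, in lattice form. Here `H_i` is the
centralizer of the `i`-th embedding in `GL_E(V)`, `T = E[w]`, `Tˣ = H₁ ∩ H₂`, and the Haar measures
give volume one to the stabilizer in `H_i` of a lattice of `𝓛_{α_i}` and to `O_Tˣ`. As `H_i` is
transitive on `𝓛_{α_i}`, this is the sum of `f(Λ₁, Λ₂) Ω(Λ₁)` over
`(𝓛_{α₁} × 𝓛_{α₂}) / Tˣ`, each orbit being counted with its mass `1 / vol(Stab)`. A bi-invariant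
function `f` on `GL_E(V)` is written as a function of two lattices, `f(Λ, gΛ) = f(g)`; `f`, `Ω` and
the mass are constant on orbits, so the choice of representative does not matter. -/
def orbitalIntegral (f : Submodule R V → Submodule R V → ℂ) (Ω : Submodule R V → ℂ) : ℂ :=
  ∑' c : Quotient (α.orbitSetoid R),
    (α.orbitMass R c.out.1 : ℂ) * (f c.out.1.1 c.out.1.2 * Ω c.out.1.1)

open Classical in
/-- The characteristic function `𝟏` of `GL(Λ)`: its value is one if `Λ₂ = Λ₁`, else zero. -/
def unitFunction (Λ₁ Λ₂ : Submodule R V) : ℂ := if Λ₁ = Λ₂ then 1 else 0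

/-- The transfer factor `Ω(Λ, s) = [Λ₋ : z Λ₊]^s (-1)^{log_q [Λ₋ : z Λ₊]}`, where `Λ₊ = ζ₀ Λ` and
`Λ₋ = σ(ζ₀) Λ`. Here `q` is the order of the residue field of the ground field `F`, over the
base `E = F` as well as over a finite étale `F`-algebra `E = L`: for `K₁ / F` unramified quadratic,
`x ↦ (-1)^{log_q |x|}` on `Lˣ` is the quadratic character of `K₁ ⊗ L / L`. -/
def transferFactor (q : ℕ) (Λ : Submodule R V) (s : ℂ) : ℂ :=
  let Λp := Λ.toAddSubgroup.map (α.fst S.gen : V →ₗ[E] V).toAddMonoidHom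
  let Λm := Λ.toAddSubgroup.map (α.fst (S.σ S.gen) : V →ₗ[E] V).toAddMonoidHom
  let i := latticeIndex Λm (Λp.map (α.z : V →ₗ[E] V).toAddMonoidHom)
  ((i : ℂ) ^ s) * (-1) ^ Int.log q i

/-- `Orb(𝟏, α)`. -/
def orb : ℂ := α.orbitalIntegral R (unitFunction R) (fun _ => 1)

/-- `Orb(𝟏, β, s)`. -/
def orbTwisted (q : ℕ) (s : ℂ) : ℂ :=
  α.orbitalIntegral R (unitFunction R) (fun Λ => α.transferFactor R q Λ s)

end Orb
section Reduced
variable {F : Type*} [Field F] {V : Type*} [AddCommGroup V] [Module F V]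
  {K K' : Type*} [CommRing K] [CommRing K'] [Algebra F K] [Algebra F K']
  {S : QuadAlg F K} {S' : QuadAlg F K'} (α : QuadPair S S' (Module.End F V))

/-- An embedding `a` whose image commutes with `w`, as a map to the `L`-linear endomorphisms,
for `L = F[w]`. -/
def linearize (a : K →ₐ[F] Module.End F V) (h : ∀ x, Commute α.w (a x)) :
    K →ₐ[F] Module.End α.L V where
  toFun x := { a x with
    map_smul' := fun l v => (LinearMap.congr_fun (α.L_comm (h x) l.2) v).symm }
  map_one' := by ext; simp
  map_zero' := by ext; simp
  map_add' x y := by ext; simp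
  map_mul' x y := by ext; simp
  commutes' r := by ext; simp

/-- The base change `a_L : L ⊗ K → End_L(V)` of an embedding `a : K → End_F(V)` whose image
commutes with `w`, for `L = F[w]`. -/
def extendToL (a : K →ₐ[F] Module.End F V) (h : ∀ x, Commute α.w (a x)) :
    α.L ⊗[F] K →ₐ[α.L] Module.End α.L V :=
  Algebra.TensorProduct.lift (Algebra.ofId α.L (Module.End α.L V)) (α.linearize a h)
    (fun l x => Algebra.commutes l _)

/-- The reduced pair `(α_{1L}, α̃) : (K L, K L) → End_L(V)` over `L = F[w]`. -/
def reduced (hS : S.GenUnit) (hz : IsUnit (1 + α.z)) :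
    QuadPair (S.baseChange α.L hS) (S.baseChange α.L hS) (Module.End α.L V) where
  fst := α.extendToL α.fst α.w_comm
  snd := α.extendToL (α.tilde hz) (α.w_comm_tilde hz)

/-- A pair is regular semisimple if `V` is a free `K`-module of rank `h` (through `α₁`), the matrix
of `w` in `Mat_h(K)` (the centralizer of `α₁`) has distinct eigenvalues over the algebraic closure,
and `z` is invertible. -/
def IsRegularSemisimple (h : ℕ) : Prop :=
  (∃ (e : (Fin h → K) ≃ₗ[F] V) (M : Matrix (Fin h) (Fin h) K),
    (∀ x v, e (x • v) = α.fst x (e v)) ∧ (∀ v, e (M.mulVec v) = α.w (e v)) ∧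
    M.charpoly.Separable) ∧ IsUnit α.z

/-- The element `w` of `L = F[w]`. -/
def wL : α.L := ⟨α.w, Algebra.self_mem_adjoin_singleton F α.w⟩

/-- The condition `O_F[w] = O_L` for `L = F[w]` (here `R = O_F`). -/
def IsMaximal (R : Type*) [CommRing R] [Algebra R F] [Module R V] [IsScalarTower R F V] : Prop :=
  Algebra.adjoin R {α.wL} = integralClosure R α.L

/-- `Orb(𝟏, (α_{1L}, α̃))`, formed over the base `L = F[w]` and its ring of integers `O_L`, the
integral closure of `R = O_F` in `L`. -/
def orbReduced (R : Type*) [CommRing R] [Algebra R F] [Module R V] [IsScalarTower R F V]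
    (hS : S.GenUnit) (hz : IsUnit (1 + α.z)) : ℂ :=
  (α.reduced hS hz).orb (integralClosure R α.L)

/-- `Orb(𝟏, (β_{1L}, β̃), s)`, formed over the base `L = F[w]` and its ring of integers `O_L`, the
integral closure of `R = O_F` in `L`. -/
def orbTwistedReduced (R : Type*) [CommRing R] [Algebra R F] [Module R V] [IsScalarTower R F V]
    (hS : S.GenUnit) (hz : IsUnit (1 + α.z)) (q : ℕ) (s : ℂ) : ℂ :=
  (α.reduced hS hz).orbTwisted (integralClosure R α.L) q s

/-- `x` is a unit of a maximal order of `End_F(V)`. The maximal orders are the rings `End(Λ₀)` for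
the full `O_F`-lattices `Λ₀ ⊂ V` (here `R = O_F`). -/
def IsMaximalOrderUnit (R : Type*) [CommRing R] [Algebra R F] [Module R V] [IsScalarTower R F V]
    (x : Module.End F V) : Prop :=
  ∃ Λ₀ : Submodule R V, Submodule.IsLattice F Λ₀ ∧ Λ₀.map (x.restrictScalars R) = Λ₀

theorem isUnit_one_add_z [FiniteDimensional F V] {R : Type*} [CommRing R] [Algebra R F]
    [Module R V] [IsScalarTower R F V] (hS : S.GenUnit) (hz : IsMaximalOrderUnit R (1 - α.z)) :
    IsUnit (1 + α.z) := by
  obtain ⟨Λ₀, hΛ, hm⟩ := hz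
  have h1 : IsUnit (1 - α.z) := by
    rw [LinearMap.isUnit_iff_range_eq_top, eq_top_iff, ← hΛ.span_eq_top, Submodule.span_le]
    intro v hv
    rw [← hm] at hv
    obtain ⟨u, -, rfl⟩ := hv
    exact ⟨u, rfl⟩
  obtain ⟨d, hd⟩ := hS.isUnit_sub.map α.fst
  have h2 : (d : Module.End F V) * α.z = -(α.z * d) := by
    rw [hd, fst_mul_z, ← mul_neg, ← map_neg, map_sub, S.σ_σ, neg_sub]
  have h3 : 1 + α.z = d * (1 - α.z) * ((d⁻¹ : (Module.End F V)ˣ) : Module.End F V) := by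
    rw [mul_sub, mul_one, h2, sub_neg_eq_add, add_mul, mul_assoc, Units.mul_inv, mul_one]
  rw [h3]
  exact (d.isUnit.mul h1).mul (d⁻¹).isUnit

end Reduced
end QuadPair

end

/-! ### Inverses of integral elements -/

section IntegralElements

/-! The unit function kills every pair of distinct lattices, so each orbital integral is a sum over
lattices stable under both embeddings, modulo the torus (`orbitalIntegral_unitFunction`). The two
sides therefore agree as soon as the lattices, the tori with their integral units, and the transfer
factors all match. Write `O_F` for `R`, `d` for `α₁(ζ - ζ^σ)`, which is a unit of `α₁(O_K)`, and `B`
for the order of endomorphisms preserving a lattice.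

Lattices (`order_contains_iff`). If `B` contains `O_K` and `O_K'`, it contains `w` and `z`, hence
`O_F[w] = O_L`. Since `d` conjugates `1 + z` to `1 - z`, the maximal order hypothesis makes `1 + z`
and its inverse integral. The inverse of an element is a polynomial in that element as soon as the
inverse is integral, so `(1 + z)⁻¹` lies in `B`, and so does `α̃(ζ)`. Conversely, `O_K` and `α̃(ζ)`
give `(1 + z)⁻¹`, hence `1 + z` by the same principle; then `d α₂(ϖ) = w - z - t' α₁(ζ^σ)`, with
`t'` the trace of `ϖ`, returns `α₂(ϖ)`.

Tori (`tilde_w`, `z_mul_z_mem_L`). The element `w` of the reduced pair is `2 ζ ζ^σ + d² (1 - z²)⁻¹`.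
As `z²` is a polynomial in `w` over `F`, this lies in `L`, so the torus of the reduced pair is again
`Lˣ`.

Transfer factors (`tilde_z`, `transferFactor_reduced`). The element `z` of the reduced pair is `z`
times `-d² (1 - z²)⁻¹`, which commutes with `α₁(ζ)` and is invertible on every lattice in the sum;
the index is unchanged.

For `(K₀, K₃)` it remains to see that `ζ₀ - ζ₀^σ` is an integral unit (its square is `1`) and that
`ϖ₃` generates the integers of `K₃` (`adjoin_quad₃_gen`). -/

theorem mem_adjoin_of_isIntegral_of_mul_eq_one {R A : Type*} [CommRing R] [Ring A] [Algebra R A]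
    {x y : A} (hyx : y * x = 1) (hy : IsIntegral R y) : y ∈ Algebra.adjoin R {x} := by
  nontriviality A
  obtain ⟨p, hp, h0⟩ := hy
  have hpow : ∀ i j : ℕ, y ^ i * x ^ (i + j) = x ^ j := by
    intro i
    induction i with
    | zero => simp
    | succ i ih =>
      intro j
      rw [pow_succ, mul_assoc, show i + 1 + j = (i + j) + 1 by ring, pow_succ', ← mul_assoc y,
        hyx, one_mul, ih]
  have hn : p.natDegree ≠ 0 := by
    intro h
    rw [hp.natDegree_eq_zero] at h
    rw [h, Polynomial.eval₂_one] at h0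
    exact one_ne_zero h0
  obtain ⟨n, hn⟩ := Nat.exists_eq_succ_of_ne_zero hn
  have hx : x ∈ Algebra.adjoin R {x} := Algebra.self_mem_adjoin_singleton R x
  -- The monic equation of `y` has degree `n + 1`; multiplied by `x ^ n` on the right, its leading
  -- term becomes `y` and every other term a nonnegative power of `x`. Only `y * x = 1` is needed,
  -- so `A` may be noncommutative.
  have h1 := congrArg (· * x ^ n) h0
  simp only [Polynomial.eval₂_eq_sum_range, hn, Finset.sum_range_succ _ (n + 1), zero_mul,
    Nat.succ_eq_add_one] at h1
  rw [← Nat.succ_eq_add_one, ← hn, hp.coeff_natDegree, map_one, one_mul, add_mul, hn,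
    Nat.succ_eq_add_one, pow_succ', mul_assoc, show y ^ n * x ^ n = 1 by simpa using hpow n 0,
    mul_one, Finset.sum_mul] at h1
  rw [eq_neg_of_add_eq_zero_right h1]
  refine neg_mem (sum_mem fun i hi => ?_)
  obtain ⟨j, rfl⟩ := Nat.exists_eq_add_of_le (Nat.lt_succ_iff.1 (Finset.mem_range.1 hi))
  rw [mul_assoc, hpow]
  exact mul_mem (algebraMap_mem _ _) (pow_mem hx _)

theorem isInt_iff_isIntegral {R E X : Type*} [CommRing R] [CommRing E] [Algebra R E] [Ring X]
    [Algebra E X] [Algebra R X] [IsScalarTower R E X] {x : X} : IsInt R E x ↔ IsIntegral R x := by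
  rw [IsInt, IsIntegral, IsScalarTower.algebraMap_eq R E X]

end IntegralElements

/-! ### The order of endomorphisms preserving a lattice -/

section Stabilizer
variable {R F V : Type*} [CommRing R] [CommRing F] [Algebra R F] [AddCommGroup V] [Module F V]
  [Module R V] [IsScalarTower R F V]

/-- The `R`-algebra of the `F`-linear endomorphisms of `V` that map `Λ` to itself. -/
def Submodule.endStabilizer (Λ : Submodule R V) : Subalgebra R (Module.End F V) where
  carrier := {x | ∀ v ∈ Λ, x v ∈ Λ}
  mul_mem' hx hy v hv := hx _ (hy v hv)
  add_mem' hx hy v hv := Λ.add_mem (hx v hv) (hy v hv)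
  algebraMap_mem' r v hv := by
    rw [Module.algebraMap_end_apply]; exact Λ.smul_mem r hv

namespace Submodule
variable {Λ : Submodule R V}

/-- The action of `endStabilizer Λ` on `Λ`. -/
def endStabilizerRestrict (Λ : Submodule R V) :
    Λ.endStabilizer (F := F) →ₐ[R] Module.End R Λ where
  toFun x := (x.1.restrictScalars R).restrict x.2
  map_one' := rfl
  map_zero' := rfl
  map_mul' _ _ := rfl
  map_add' _ _ := rfl
  commutes' r := by
    ext v
    change (algebraMap R (Module.End F V) r) (v : V) = _
    simp [Module.algebraMap_end_apply]

theorem endStabilizerRestrict_injective (hΛ : Λ.IsLattice F) :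
    Function.Injective (Λ.endStabilizerRestrict (F := F)) := by
  intro x y hxy
  refine Subtype.ext (LinearMap.ext_on (s := Λ) hΛ.span_eq_top fun v hv => ?_)
  exact congrArg Subtype.val (LinearMap.congr_fun hxy ⟨v, hv⟩)

/-- Cayley–Hamilton on the finitely generated module `Λ`; the equation lifts to `V` because `Λ`
spans `V`. -/
theorem isIntegral_of_mem_endStabilizer (hΛ : Λ.IsLattice F) {x : Module.End F V}
    (hx : x ∈ Λ.endStabilizer) : IsIntegral R x := by
  have : Module.Finite R Λ := Module.Finite.iff_fg.2 hΛ.fg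
  have h := (isIntegral_algHom_iff _ (endStabilizerRestrict_injective hΛ)).1
    (Algebra.IsIntegral.isIntegral (R := R) (Λ.endStabilizerRestrict (⟨x, hx⟩ : Λ.endStabilizer)))
  exact h.map (Λ.endStabilizer (F := F)).val

end Submodule
end Stabilizer

/-! ### Identities in quadratic algebras and for pairs -/

namespace QuadAlg
variable {F K : Type*} [CommRing F] [CommRing K] [Algebra F K] (S : QuadAlg F K)

/-- If `O_K` contains the generator and `(gen - σ gen)⁻¹`, then `O_K = O_F + O_F gen`. -/
theorem exists_integral_coords {R : Type*} [CommRing R] [Algebra R F] [Algebra R K]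
    [IsScalarTower R F K] (hinj : Function.Injective (algebraMap F K)) (hg : IsIntegral R S.gen)
    {e : K} (he : (S.gen - S.σ S.gen) * e = 1) (hei : IsIntegral R e) {x : K}
    (hx : IsIntegral R x) :
    ∃ r s : F, IsIntegral R r ∧ IsIntegral R s ∧ x = algebraMap F K r + s • S.gen := by
  obtain ⟨r, s, rfl⟩ := S.span x
  have hσ : ∀ y, IsIntegral R y → IsIntegral R (S.σ y) := fun y hy =>
    hy.map ((S.σ : K →ₐ[F] K).restrictScalars R)
  have hs : IsIntegral R s := by
    -- For `x = r + s ζ`, the difference `x - σ x` is `s (ζ - σ ζ)`, so multiplying by `e` isolates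
    -- `s`.
    have h1 : IsIntegral R ((algebraMap F K r + s • S.gen - S.σ (algebraMap F K r + s • S.gen)) * e) :=
      (hx.sub (hσ _ hx)).mul hei
    have h2 : (algebraMap F K r + s • S.gen - S.σ (algebraMap F K r + s • S.gen)) * e =
        algebraMap F K s := by
      rw [map_add, AlgEquiv.commutes, map_smul, Algebra.smul_def, Algebra.smul_def]
      linear_combination (algebraMap F K s) * he
    rw [h2] at h1
    exact (isIntegral_algHom_iff (IsScalarTower.toAlgHom R F K) hinj).1 h1
  refine ⟨r, s, ?_, hs, rfl⟩
  have h1 : IsIntegral R (algebraMap F K r + s • S.gen - algebraMap F K s * S.gen) :=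
    hx.sub ((hs.map (IsScalarTower.toAlgHom R F K)).mul hg)
  rw [Algebra.smul_def, add_sub_cancel_right] at h1
  exact (isIntegral_algHom_iff (IsScalarTower.toAlgHom R F K) hinj).1 h1

end QuadAlg

namespace QuadPair
variable {F K K' A : Type*} [Field F] [CommRing K] [CommRing K'] [Algebra F K]
    [Algebra F K'] {S : QuadAlg F K} {S' : QuadAlg F K'} [Ring A] [Algebra F A]
    (α : QuadPair S S' A)

/-- When `ζ - σ ζ` is invertible, this recovers the second embedding from `w`, `z` and the first. -/
theorem fst_sub_mul_snd : ∃ t' : F, algebraMap F K' t' = S'.gen + S'.σ S'.gen ∧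
    α.fst (S.gen - S.σ S.gen) * α.snd S'.gen = α.w - α.z - t' • α.fst (S.σ S.gen) := by
  obtain ⟨t, ht⟩ := S.exists_trace S.gen
  obtain ⟨t', ht'⟩ := S'.exists_trace S'.gen
  refine ⟨t', ht', ?_⟩
  have hσ : α.fst (S.σ S.gen) = algebraMap F A t - α.fst S.gen := by
    rw [← AlgHom.commutes α.fst, ht, map_add]; abel
  have hσ' : α.snd (S'.σ S'.gen) = algebraMap F A t' - α.snd S'.gen := by
    rw [← AlgHom.commutes α.snd, ht', map_add]; abel
  rw [w, z, map_sub, hσ, hσ']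
  simp only [Algebra.algebraMap_eq_smul_one, mul_sub, sub_mul, smul_mul_assoc,
      mul_smul_comm, one_mul, mul_one]
  module

theorem z_mul_z_mem_L : α.z * α.z ∈ α.L := by
  obtain ⟨t, ht⟩ := S.exists_trace S.gen
  obtain ⟨n, hn⟩ := S.exists_norm S.gen
  obtain ⟨t', ht'⟩ := S'.exists_trace S'.gen
  obtain ⟨n', hn'⟩ := S'.exists_norm S'.gen
  have hσ : α.fst (S.σ S.gen) = algebraMap F A t - α.fst S.gen := by
    rw [← AlgHom.commutes α.fst, ht, map_add]; abel
  have hσ' : α.snd (S'.σ S'.gen) = algebraMap F A t' - α.snd S'.gen := by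
    rw [← AlgHom.commutes α.snd, ht', map_add]; abel
  have hsq : α.fst S.gen * α.fst S.gen = t • α.fst S.gen - n • 1 := by
    rw [← map_mul, ← map_smul, ← map_one α.fst, ← map_smul, ← map_sub,
      ← Algebra.algebraMap_eq_smul_one, hn, Algebra.smul_def, ht]
    congr 1; ring
  have hsq' : α.snd S'.gen * α.snd S'.gen = t' • α.snd S'.gen - n' • 1 := by
    rw [← map_mul, ← map_smul, ← map_one α.snd, ← map_smul, ← map_sub,
      ← Algebra.algebraMap_eq_smul_one, hn', Algebra.smul_def, ht']
    congr 1; ring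
  -- Both generators satisfy quadratic equations, with traces `t`, `t'` and norms `n`, `n'`;
  -- reducing words in them makes `z²` a quadratic polynomial in `w`.
  have key : α.z * α.z = α.w * α.w - (t * t') • α.w +
      (t' ^ 2 * n + t ^ 2 * n' - 4 * n * n') • (1 : A) := by
    rw [w, z, hσ, hσ']
    set a := α.fst S.gen
    set b := α.snd S'.gen
    have e1 (x : A) : x * a * a = t • (x * a) - n • x := by rw [mul_assoc, hsq]; simp [mul_sub]
    have e2 (x : A) : x * b * b = t' • (x * b) - n' • x := by rw [mul_assoc, hsq']; simp [mul_sub]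
    simp only [Algebra.algebraMap_eq_smul_one, mul_add, add_mul, mul_sub, sub_mul, smul_mul_assoc,
      mul_smul_comm, one_mul, mul_one, ← mul_assoc, e1, e2, hsq, hsq']
    module
  rw [key]
  have hw : α.w ∈ α.L := Algebra.self_mem_adjoin_singleton F α.w
  exact add_mem (sub_mem (mul_mem hw hw) (α.L.smul_mem hw _)) (α.L.smul_mem α.L.one_mem _)

theorem tilde_eq (hz : IsUnit (1 + α.z)) (x : K) : α.tilde hz x =
    Ring.inverse (1 + α.z) * α.fst (x - S.σ x) + α.fst (S.σ x) := by
  rw [map_sub]; rfl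

theorem fst_sub_mul_z : α.fst (S.gen - S.σ S.gen) * α.z = -(α.z * α.fst (S.gen - S.σ S.gen)) := by
  rw [fst_mul_z, ← mul_neg, ← map_neg, map_sub, S.σ_σ, neg_sub]

/-- The image of `ζ - σ ζ` anticommutes with `z`, so it intertwines `1 + z` with `1 - z` and hence
their inverses. -/
theorem fst_sub_mul_inverse (hz : IsUnit (1 + α.z)) {v : A} (hv' : v * (1 - α.z) = 1) :
    α.fst (S.gen - S.σ S.gen) * Ring.inverse (1 + α.z) = v * α.fst (S.gen - S.σ S.gen) := by
  have h3 : α.fst (S.gen - S.σ S.gen) * (1 + α.z) = (1 - α.z) * α.fst (S.gen - S.σ S.gen) := by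
    rw [mul_add, fst_sub_mul_z, sub_mul]; simp [sub_eq_add_neg]
  calc _ = v * ((1 - α.z) * α.fst (S.gen - S.σ S.gen)) * Ring.inverse (1 + α.z) := by
        rw [← mul_assoc, hv', one_mul]
    _ = _ := by rw [← h3, mul_assoc, mul_assoc, Ring.mul_inverse_cancel _ hz, mul_one]

/-- From `z ζ = ζ^σ z` one gets `ζ^σ (1 + z) = (1 + z) ζ - (ζ - ζ^σ)`; multiply by `(1 + z)⁻¹` on
both sides. -/
theorem inverse_mul_fst_σ (hz : IsUnit (1 + α.z)) : Ring.inverse (1 + α.z) * α.fst (S.σ S.gen) =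
    α.fst S.gen * Ring.inverse (1 + α.z) -
      Ring.inverse (1 + α.z) * α.fst (S.gen - S.σ S.gen) * Ring.inverse (1 + α.z) := by
  have h1 : α.fst (S.σ S.gen) * (1 + α.z) =
      (1 + α.z) * α.fst S.gen - α.fst (S.gen - S.σ S.gen) := by
    rw [mul_add, add_mul, fst_mul_z, S.σ_σ, map_sub]; simp; abel
  calc _ = Ring.inverse (1 + α.z) * (α.fst (S.σ S.gen) * (1 + α.z)) * Ring.inverse (1 + α.z) := by
        rw [mul_assoc, mul_assoc, Ring.mul_inverse_cancel _ hz, mul_one]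
    _ = _ := by rw [h1, mul_sub, ← mul_assoc, Ring.inverse_mul_cancel _ hz, one_mul, sub_mul]

/-- The element `w` of the reduced pair is `2 ζ ζ^σ + (ζ - ζ^σ)² (1 - z²)⁻¹`. -/
theorem tilde_w (hz : IsUnit (1 + α.z)) {v : A} (hv' : v * (1 - α.z) = 1) :
    α.fst S.gen * α.tilde hz S.gen + α.tilde hz (S.σ S.gen) * α.fst (S.σ S.gen) =
      2 * α.fst (S.gen * S.σ S.gen) +
        Ring.inverse (1 + α.z) * v * α.fst ((S.gen - S.σ S.gen) * (S.gen - S.σ S.gen)) := by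
  have h2 := α.inverse_mul_fst_σ hz
  have h4 := α.fst_sub_mul_inverse hz hv'
  have h5 : α.fst (S.gen - S.σ S.gen) * α.fst (S.σ S.gen) =
      α.fst (S.σ S.gen) * α.fst (S.gen - S.σ S.gen) := by rw [← map_mul, ← map_mul, mul_comm]
  have h6 : α.fst (S.σ S.gen - S.gen) = -α.fst (S.gen - S.σ S.gen) := by rw [← map_neg, neg_sub]
  rw [tilde_eq, tilde_eq, S.σ_σ, h6, map_mul, map_mul α.fst (_ - _)]
  generalize α.fst (S.gen - S.σ S.gen) = d at *
  generalize Ring.inverse (1 + α.z) = u at *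
  generalize α.fst S.gen = a at *
  generalize α.fst (S.σ S.gen) = a' at *
  have h8 : u * v * (d * d) = u * d * u * d := by
    rw [mul_assoc u d u, h4]; simp only [mul_assoc]
  -- The term `a * u * d` cancels against the one coming from `a * α̃(ζ)`, and `u * d * u * d` is
  -- the wanted summand by `h8`.
  have h9 : u * d * a' = a * u * d - u * d * u * d := by
    rw [mul_assoc, h5, ← mul_assoc, h2, sub_mul]
  rw [h8, mul_add, add_mul, mul_neg, neg_mul, h9, two_mul, ← mul_assoc]
  abel

/-- The element `z` of the reduced pair is `-z (ζ - ζ^σ)² (1 - z²)⁻¹`. -/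
theorem tilde_z (hz : IsUnit (1 + α.z)) {v : A} (hv' : v * (1 - α.z) = 1) :
    α.tilde hz S.gen * α.fst S.gen - α.fst S.gen * α.tilde hz S.gen =
      -(α.z * (Ring.inverse (1 + α.z) * v *
        α.fst ((S.gen - S.σ S.gen) * (S.gen - S.σ S.gen)))) := by
  have h2 := α.inverse_mul_fst_σ hz
  have h4 := α.fst_sub_mul_inverse hz hv'
  have h7 := α.fst_sub_mul_z
  have h5 : α.fst (S.gen - S.σ S.gen) * α.fst S.gen =
      α.fst S.gen * α.fst (S.gen - S.σ S.gen) := by rw [← map_mul, ← map_mul, mul_comm]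
  have h5' : α.fst S.gen * α.fst (S.σ S.gen) =
      α.fst (S.σ S.gen) * α.fst S.gen := by rw [← map_mul, ← map_mul, mul_comm]
  have hd : α.fst S.gen - α.fst (S.σ S.gen) = α.fst (S.gen - S.σ S.gen) := (map_sub _ _ _).symm
  have hu1 := Ring.inverse_mul_cancel _ hz
  have hu2 := Ring.mul_inverse_cancel _ hz
  rw [tilde_eq, map_mul α.fst (_ - _)]
  generalize α.fst (S.gen - S.σ S.gen) = d at *
  generalize Ring.inverse (1 + α.z) = u at *
  generalize α.fst S.gen = a at *
  generalize α.fst (S.σ S.gen) = a' at *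
  generalize α.z = z at *
  -- As `u = (1 + z)⁻¹`, the difference `1 - u` equals both `z u` and `u z`, which lets `z` change
  -- sides.
  have hzu : 1 - u = z * u := by rw [← hu2]; rw [add_mul]; simp
  have hzu' : 1 - u = u * z := by rw [← hu1]; rw [mul_add]; simp
  have h8 : u * a - a * u = -(z * (u * v * d)) := by
    calc u * a - a * u = u * d * (1 - u) := by
          rw [show u * a = u * d + u * a' by rw [← hd, mul_sub, sub_add_cancel], h2]; noncomm_ring
      _ = u * (d * z) * u := by rw [hzu]; noncomm_ring
      _ = -(u * z * (d * u)) := by rw [h7]; noncomm_ring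
      _ = _ := by rw [← hzu', hzu, h4]; noncomm_ring
  -- The summand `a'` of `α̃(ζ)` commutes with `a`, so only the commutator of `u` with `a` survives.
  calc _ = (u * a - a * u) * d := by
        rw [add_mul, mul_add, mul_assoc, h5, h5']; noncomm_ring
    _ = _ := by rw [h8]; noncomm_ring

end QuadPair

/-- Conjugation is an algebra endomorphism. It carries integrality between `1 - z` and `1 + z`, and
between their inverses. -/
theorem IsIntegral.conj {R A : Type*} [CommRing R] [Ring A] [Algebra R A] {x d e : A}
    (hx : IsIntegral R x) (hde : d * e = 1) (hed : e * d = 1) : IsIntegral R (d * x * e) := by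
  let f : A →ₐ[R] A :=
    { toFun := fun y => d * y * e
      map_one' := by rw [mul_one, hde]
      map_mul' := fun y y' => by
        calc d * (y * y') * e = d * y * 1 * y' * e := by simp only [mul_assoc, mul_one]
          _ = _ := by rw [← hed]; simp only [mul_assoc]
      map_zero' := by simp
      map_add' := fun y y' => by rw [mul_add, add_mul]
      commutes' := fun r => by rw [← Algebra.commutes, mul_assoc, hde, mul_one] }
  exact hx.map f

theorem AlgHom.map_mem_of_adjoin_eq_integralClosure {R K A : Type*} [CommRing R] [CommRing K]
    [Ring A] [Algebra R K] [Algebra R A] (f : K →ₐ[R] A) {g : K} {B : Subalgebra R A}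
    (h : Algebra.adjoin R {g} = integralClosure R K) (hg : f g ∈ B) {x : K} (hx : IsIntegral R x) :
    f x ∈ B := by
  have h1 : integralClosure R K ≤ B.comap f := by
    rw [← h]; exact Algebra.adjoin_le (Set.singleton_subset_iff.2 hg)
  exact h1 hx

theorem isIntegral_of_adjoin_eq_integralClosure {R K : Type*} [CommRing R] [CommRing K]
    [Algebra R K] {g : K} (h : Algebra.adjoin R {g} = integralClosure R K) : IsIntegral R g := by
  have : g ∈ integralClosure R K := h ▸ Algebra.self_mem_adjoin_singleton R g
  exact this

/-! ### Orders containing the two rings of integers -/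

namespace QuadPair
variable {R F V K K' : Type*} [CommRing R] [Field F] [Algebra R F] [AddCommGroup V] [Module F V]
  [Module R V] [IsScalarTower R F V] [CommRing K] [CommRing K'] [Algebra F K] [Algebra F K']
  {S : QuadAlg F K} {S' : QuadAlg F K'} (α : QuadPair S S' (Module.End F V))

/-- Both `x` and its inverse preserve the lattice `Λ₀`. -/
theorem IsMaximalOrderUnit.exists_integral_inverse [FiniteDimensional F V] {x : Module.End F V}
    (h : IsMaximalOrderUnit R x) :
    IsIntegral R x ∧ ∃ v, x * v = 1 ∧ v * x = 1 ∧ IsIntegral R v := by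
  obtain ⟨Λ₀, hΛ, hm⟩ := h
  have h1 : IsUnit x := by
    rw [LinearMap.isUnit_iff_range_eq_top, eq_top_iff, ← hΛ.span_eq_top, Submodule.span_le]
    intro v hv
    rw [← hm] at hv
    obtain ⟨u, -, rfl⟩ := hv
    exact ⟨u, rfl⟩
  refine ⟨Submodule.isIntegral_of_mem_endStabilizer hΛ fun v hv => ?_, ?_⟩
  · rw [← hm]; exact ⟨v, hv, rfl⟩
  obtain ⟨u, rfl⟩ := h1
  refine ⟨((u⁻¹ : (Module.End F V)ˣ) : Module.End F V), u.mul_inv, u.inv_mul,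
    Submodule.isIntegral_of_mem_endStabilizer hΛ fun v hv => ?_⟩
  rw [← hm] at hv
  obtain ⟨y, hy, rfl⟩ := hv
  have : ((u⁻¹ : (Module.End F V)ˣ) : Module.End F V) ((u : Module.End F V) y) = y :=
    LinearMap.congr_fun u.inv_mul y
  change ((u⁻¹ : (Module.End F V)ˣ) : Module.End F V) ((u : Module.End F V) y) ∈ Λ₀
  rwa [this]

section Stability
variable {α} {e : K} {v : Module.End F V}

theorem isIntegral_one_add_z (he : (S.gen - S.σ S.gen) * e = 1) (h : IsIntegral R (1 - α.z)) :
    IsIntegral R (1 + α.z) := by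
  have h1 : α.fst (S.gen - S.σ S.gen) * α.fst e = 1 := by rw [← map_mul, he, map_one]
  have h2 : α.fst e * α.fst (S.gen - S.σ S.gen) = 1 := by rw [← map_mul, mul_comm, he, map_one]
  have := h.conj h1 h2
  rwa [mul_sub, fst_sub_mul_z, sub_neg_eq_add, mul_one, add_mul, mul_assoc α.z, h1, mul_one] at this

theorem isIntegral_inverse_one_add_z (hz : IsUnit (1 + α.z))
    (he : (S.gen - S.σ S.gen) * e = 1) (hv : v * (1 - α.z) = 1) (h : IsIntegral R v) :
    IsIntegral R (Ring.inverse (1 + α.z)) := by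
  have h1 : α.fst (S.gen - S.σ S.gen) * α.fst e = 1 := by rw [← map_mul, he, map_one]
  have h2 : α.fst e * α.fst (S.gen - S.σ S.gen) = 1 := by rw [← map_mul, mul_comm, he, map_one]
  have := h.conj h2 h1
  rwa [mul_assoc, ← fst_sub_mul_inverse α hz hv, ← mul_assoc, h2, one_mul] at this

variable {B : Subalgebra R (Module.End F V)}

/-- This is how `O_F[w] = O_L` turns a lattice stable under both embeddings, hence under `w`, into
an `O_L`-module. -/
theorem coe_mem_of_isMaximal (hmax : α.IsMaximal R) (hw : α.w ∈ B) {l : α.L}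
    (hl : IsIntegral R l) : (l : Module.End F V) ∈ B :=
  AlgHom.map_mem_of_adjoin_eq_integralClosure (α.L.val.restrictScalars R) hmax hw hl

variable [Algebra R K] [Algebra R K']

theorem z_mem (h₁ : ∀ x : K, IsIntegral R x → α.fst x ∈ B)
    (h₂ : ∀ x : K', IsIntegral R x → α.snd x ∈ B)
    (hg : IsIntegral R S.gen) (hg' : IsIntegral R S'.gen) : α.z ∈ B :=
  sub_mem (mul_mem (h₂ _ hg') (h₁ _ hg)) (mul_mem (h₁ _ hg) (h₂ _ hg'))

variable [IsScalarTower R F K] [IsScalarTower R F K']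

theorem w_mem (h₁ : ∀ x : K, IsIntegral R x → α.fst x ∈ B)
    (h₂ : ∀ x : K', IsIntegral R x → α.snd x ∈ B)
    (hg : IsIntegral R S.gen) (hg' : IsIntegral R S'.gen) : α.w ∈ B := by
  refine add_mem (mul_mem (h₁ _ hg) (h₂ _ hg')) (mul_mem (h₂ _ ?_) (h₁ _ ?_))
  · exact hg'.map ((S'.σ : K' →ₐ[F] K').restrictScalars R)
  · exact hg.map ((S.σ : K →ₐ[F] K).restrictScalars R)

/-- An `R`-order contains `O_K` and `O_K'` if and only if it contains `O_L`, `O_K`, and the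
generator of the second embedding of the reduced pair. -/
theorem order_contains_iff [Nontrivial K'] [IsIntegrallyClosed R] [IsDomain R] [IsFractionRing R F]
    (hz : IsUnit (1 + α.z)) (hmax : α.IsMaximal R)
    (hg : IsIntegral R S.gen) (he : (S.gen - S.σ S.gen) * e = 1) (hei : IsIntegral R e)
    (hK' : Algebra.adjoin R {S'.gen} = integralClosure R K')
    (hi : IsIntegral R (1 - α.z)) (hv : v * (1 - α.z) = 1) (hvi : IsIntegral R v) :
    ((∀ x : K, IsIntegral R x → α.fst x ∈ B) ∧ ∀ x : K', IsIntegral R x → α.snd x ∈ B) ↔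
      (∀ l : α.L, IsIntegral R l → (l : Module.End F V) ∈ B) ∧
        (∀ x : K, IsIntegral R x → α.fst x ∈ B) ∧ α.tilde hz S.gen ∈ B := by
  have hg' := isIntegral_of_adjoin_eq_integralClosure hK'
  have hσ : IsIntegral R (S.σ S.gen) := hg.map ((S.σ : K →ₐ[F] K).restrictScalars R)
  have hui := isIntegral_inverse_one_add_z hz he hv hvi
  have hpi := isIntegral_one_add_z he hi
  have h1 : α.fst (S.gen - S.σ S.gen) * α.fst e = 1 := by rw [← map_mul, he, map_one]
  have h2 : α.fst e * α.fst (S.gen - S.σ S.gen) = 1 := by rw [← map_mul, mul_comm, he, map_one]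
  constructor
  · rintro ⟨h₁, h₂⟩
    refine ⟨fun l hl => coe_mem_of_isMaximal hmax (w_mem h₁ h₂ hg hg') hl, h₁, ?_⟩
    rw [tilde_eq]
    refine add_mem (mul_mem ?_ (h₁ _ (hg.sub hσ))) (h₁ _ hσ)
    -- The inverse of `1 + z` is integral, so it is a polynomial in `1 + z` over `R` and stays in
    -- `B`.
    exact Algebra.adjoin_le (Set.singleton_subset_iff.2 (add_mem B.one_mem (z_mem h₁ h₂ hg hg')))
      (mem_adjoin_of_isIntegral_of_mul_eq_one (Ring.inverse_mul_cancel _ hz) hui)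
  · rintro ⟨hL, h₁, ht⟩
    refine ⟨h₁, fun x hx => AlgHom.map_mem_of_adjoin_eq_integralClosure
      (α.snd.restrictScalars R) hK' ?_ hx⟩
    have hu : Ring.inverse (1 + α.z) ∈ B := by
      -- The formula for `α̃(ζ)` solved for `(1 + z)⁻¹`, with `e` the inverse of `ζ - σ ζ`.
      have h3 : Ring.inverse (1 + α.z) = (α.tilde hz S.gen - α.fst (S.σ S.gen)) * α.fst e := by
        rw [tilde_eq, add_sub_cancel_right, mul_assoc, h1, mul_one]
      rw [h3]
      exact mul_mem (sub_mem ht (h₁ _ hσ)) (h₁ _ hei)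
    have hzB : α.z ∈ B := by
      have : 1 + α.z ∈ B := Algebra.adjoin_le (Set.singleton_subset_iff.2 hu)
        (mem_adjoin_of_isIntegral_of_mul_eq_one (Ring.mul_inverse_cancel _ hz) hpi)
      simpa using sub_mem this B.one_mem
    obtain ⟨t', ht', hb⟩ := α.fst_sub_mul_snd
    -- The trace of `ϖ` must be a scalar of `R`, since `B` is only an `R`-algebra.
    obtain ⟨r, rfl⟩ : ∃ r : R, algebraMap R F r = t' := by
      refine IsIntegrallyClosed.algebraMap_eq_of_integral
        ((isIntegral_algHom_iff (IsScalarTower.toAlgHom R F K') (algebraMap F K').injective).1 ?_)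
      change IsIntegral R (algebraMap F K' t')
      rw [ht']
      exact hg'.add (hg'.map ((S'.σ : K' →ₐ[F] K').restrictScalars R))
    have hw : α.w ∈ B := hL α.wL (isIntegral_of_adjoin_eq_integralClosure hmax)
    change α.snd S'.gen ∈ B
    have h4 : α.snd S'.gen = α.fst e * (α.w - α.z - algebraMap R F r • α.fst (S.σ S.gen)) := by
      rw [← hb, ← mul_assoc, h2, one_mul]
    rw [h4, algebraMap_smul]
    exact mul_mem (h₁ _ hei) (sub_mem (sub_mem hw hzB) (B.smul_mem (h₁ _ hσ) r))

end Stability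
end QuadPair

/-! ### Orbital integrals as sums over common lattices -/

open scoped Pointwise

namespace QuadPair

section Sum
variable (R : Type*) {E : Type*} [CommRing R] [CommRing E] [Algebra R E]
  {V : Type*} [AddCommGroup V] [Module E V] [Module R V] [IsScalarTower R E V]
  {K K' : Type*} [CommRing K] [CommRing K'] [Algebra E K] [Algebra E K']
  {S : QuadAlg E K} {S' : QuadAlg E K'} (α : QuadPair S S' (Module.End E V))

/-- The lattices in `𝓛_{α₁} ∩ 𝓛_{α₂}`. -/
abbrev CommonLattices : Type _ :=
  {Λ : Submodule R V // Λ ∈ stableLattices R E α.fst ∧ Λ ∈ stableLattices R E α.snd}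

/-- Two common lattices are equivalent if they lie in one orbit of `E[w]ˣ`. -/
def commonSetoid : Setoid (α.CommonLattices R) :=
  (MulAction.orbitRel (α.L)ˣ (Submodule R V)).comap Subtype.val

variable {R}

theorem stabilizer_prod_self (Λ : Submodule R V) :
    MulAction.stabilizer (α.L)ˣ (Λ, Λ) = MulAction.stabilizer (α.L)ˣ Λ := by
  ext g
  simp [MulAction.mem_stabilizer_iff]

/-- The torus is commutative, so stabilizers are constant along an orbit. -/
theorem stabilizer_units_smul (g : (α.L)ˣ) (Λ : Submodule R V) :
    MulAction.stabilizer (α.L)ˣ (g • Λ) = MulAction.stabilizer (α.L)ˣ Λ := by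
  ext x
  rw [MulAction.mem_stabilizer_iff, MulAction.mem_stabilizer_iff, smul_smul, mul_comm, mul_smul,
    smul_left_cancel_iff]

/-- The orbital integral of the unit function is a sum over the orbits of common lattices. -/
theorem orbitalIntegral_unitFunction {Ω : Submodule R V → ℂ}
    (hΩ : ∀ (g : (α.L)ˣ) (Λ : Submodule R V), Ω (g • Λ) = Ω Λ) :
    α.orbitalIntegral R (unitFunction R) Ω =
      ∑' c : Quotient (α.commonSetoid R),
        ((MulAction.stabilizer (α.L)ˣ c.out.1).relIndex (intUnits R E α.L) : ℂ) * Ω c.out.1 := by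
  let ι : Quotient (α.commonSetoid R) → Quotient (α.orbitSetoid R) :=
    Quotient.map' (fun Λ => ⟨(Λ.1, Λ.1), Λ.2⟩) (by
      rintro Λ Λ' ⟨g, hg⟩
      exact ⟨g, Prod.ext hg hg⟩)
  have hι : Function.Injective ι := by
    intro c c'
    refine Quotient.inductionOn₂ c c' fun Λ Λ' h => Quotient.sound ?_
    obtain ⟨g, hg⟩ := Quotient.exact h
    exact ⟨g, congrArg Prod.fst hg⟩
  rw [orbitalIntegral, ← hι.tsum_eq]
  · refine tsum_congr fun c => ?_
    -- The representative chosen for `ι c` need not be the diagonal of the one chosen for `c`; a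
    -- torus element `g` relates them, and mass and `Ω` do not see it.
    obtain ⟨g, hg⟩ : (α.orbitSetoid R).r (ι c).out ⟨(c.out.1, c.out.1), c.out.2⟩ := by
      refine Quotient.exact ?_
      rw [Quotient.out_eq]
      conv_lhs => rw [← Quotient.out_eq c]
      rfl
    have hg' : (ι c).out.1 = (g • c.out.1, g • c.out.1) := hg.symm
    rw [hg', orbitMass, stabilizer_prod_self, stabilizer_units_smul, hΩ, unitFunction, if_pos rfl,
      one_mul]
  -- A nonzero term forces the two lattices to be equal, so the support lies in the image of the
  -- diagonal map `ι`.
  · intro c hc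
    have h : c.out.1.1 = c.out.1.2 := by
      by_contra h
      exact hc (by simp [unitFunction, h])
    refine ⟨⟦⟨c.out.1.1, c.out.2.1, h ▸ c.out.2.2⟩⟧, ?_⟩
    conv_rhs => rw [← Quotient.out_eq c]
    refine congrArg (Quotient.mk _) (Subtype.ext (Prod.ext rfl h))

theorem L_mul_comm {x : Module.End E V} (hx : Commute α.w x) (g : (α.L)ˣ) :
    (((g : α.L) : Module.End E V)) * x = x * ((g : α.L) : Module.End E V) :=
  α.L_comm hx (g : α.L).2

theorem latticeIndex_map {X : Type*} [AddCommGroup X] (A B : AddSubgroup X) {f : X →+ X}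
    (hf : Function.Injective f) : latticeIndex (A.map f) (B.map f) = latticeIndex A B := by
  rw [latticeIndex, latticeIndex, AddSubgroup.relIndex_map_map_of_injective _ _ hf,
    AddSubgroup.relIndex_map_map_of_injective _ _ hf]

/-- The action of `g` commutes with `α₁(ζ)`, `α₁(σ ζ)` and `z`, so both lattices in the index are
moved by the same injective map. -/
theorem transferFactor_units_smul (q : ℕ) (g : (α.L)ˣ) (Λ : Submodule R V) (s : ℂ) :
    α.transferFactor R q (g • Λ) s = α.transferFactor R q Λ s := by
  set f : V →+ V := (((g : α.L) : Module.End E V) : V →ₗ[E] V).toAddMonoidHom with hf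
  have hinj : Function.Injective f := by
    intro v v' h
    exact smul_left_cancel g h
  have hmap (x : Module.End E V) (hx : Commute α.w x) (A : AddSubgroup V) :
      (A.map f).map (x : V →ₗ[E] V).toAddMonoidHom =
        (A.map (x : V →ₗ[E] V).toAddMonoidHom).map f := by
    rw [AddSubgroup.map_map, AddSubgroup.map_map]
    congr 1
    ext v
    exact LinearMap.congr_fun (α.L_mul_comm hx g).symm v
  have hΛ : (g • Λ).toAddSubgroup = Λ.toAddSubgroup.map f := rfl
  simp only [transferFactor, hΛ]
  rw [hmap _ (α.w_comm _), hmap _ (α.w_comm _), hmap _ α.w_comm_z, latticeIndex_map _ _ hinj]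

end Sum
end QuadPair

theorem AlgHom.algebraMap_add_smul_apply {E X V : Type*} [CommRing E] [Ring X] [Algebra E X]
    [AddCommGroup V] [Module E V] (f : X →ₐ[E] Module.End E V) (r s : E) (x : X) (v : V) :
    f (algebraMap E X r + s • x) v = r • v + s • f x v := by
  rw [map_add, map_smul, AlgHom.commutes]; rfl

/-- Finite generation passes between `O` and `R` because `O` is finite over `R`. For spanning, each
`l` in `L` has a denominator in `R`, so the `F`-span of an `O`-module is already an `L`-subspace. -/
theorem Submodule.isLattice_restrictScalars_iff {R O F L V : Type*} [CommRing R] [CommRing O]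
    [Field F] [CommRing L] [Algebra R O] [Algebra R F] [Algebra O L] [Algebra F L] [Algebra R L]
    [IsScalarTower R O L] [IsScalarTower R F L] [AddCommGroup V] [Module R V] [Module O V]
    [Module F V] [Module L V] [IsScalarTower R O V] [IsScalarTower O L V] [IsScalarTower R F V]
    [IsScalarTower F L V] [IsScalarTower R L V] [Module.Finite R O]
    (hden : ∀ l : L, ∃ r : R, algebraMap R F r ≠ 0 ∧ ∃ o : O, algebraMap O L o = r • l)
    (M : Submodule O V) : (M.restrictScalars R).IsLattice F ↔ M.IsLattice L := by
  constructor
  · rintro ⟨h1, h2⟩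
    refine ⟨?_, ?_⟩
    · have : Module.Finite R M := Module.Finite.iff_fg.2 h1
      exact Module.Finite.iff_fg.1 (Module.Finite.of_restrictScalars_finite R _ M)
    · rw [← Submodule.restrictScalars_eq_top_iff F, eq_top_iff, ← h2, Submodule.span_le]
      exact fun x hx => Submodule.subset_span hx
  · rintro ⟨h1, h2⟩
    refine ⟨?_, ?_⟩
    · have : Module.Finite O M := Module.Finite.iff_fg.2 h1
      exact Module.Finite.iff_fg.1 (Module.Finite.trans (R := R) O M)
    · let N : Submodule L V :=
        { Submodule.span F (M : Set V) with
          smul_mem' := by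
            intro l x hx
            induction hx using Submodule.span_induction with
            | mem x hx =>
              obtain ⟨r, hr, o, ho⟩ := hden l
              have h3 : (r • l) • x ∈ Submodule.span F (M : Set V) := by
                rw [← ho, algebraMap_smul]
                exact Submodule.subset_span (M.smul_mem o hx)
              have h4 : l • x = (algebraMap R F r)⁻¹ • ((r • l) • x) := by
                rw [smul_assoc, ← algebraMap_smul F r, inv_smul_smul₀ hr]
              change l • x ∈ Submodule.span F (M : Set V)
              rw [h4]
              exact Submodule.smul_mem _ _ h3
            | zero => rw [smul_zero]; exact Submodule.zero_mem _
            | add x y _ _ hx hy => rw [smul_add]; exact Submodule.add_mem _ hx hy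
            | smul f x _ hx =>
              rw [← algebraMap_smul L f, smul_smul, mul_comm, ← smul_smul, algebraMap_smul]
              exact Submodule.smul_mem _ _ hx }
      have h3 : Submodule.span L (M : Set V) ≤ N := Submodule.span_le.2 Submodule.subset_span
      rw [h2] at h3
      exact eq_top_iff.2 fun x _ => h3 (Submodule.mem_top (x := x))

/-! ### The reduced pair over `L` -/

namespace QuadPair
variable {R F V K K' : Type*} [CommRing R] [Field F] [Algebra R F] [AddCommGroup V] [Module F V]
  [Module R V] [IsScalarTower R F V] [CommRing K] [CommRing K'] [Algebra F K] [Algebra F K']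
  {S : QuadAlg F K} {S' : QuadAlg F K'} (α : QuadPair S S' (Module.End F V))

/-- A shortcut for instance search. -/
instance algebraEndL : Algebra α.L (Module.End α.L V) := Module.End.instAlgebra α.L α.L V

/-- A shortcut for instance search. -/
instance isScalarTower_integralClosure : IsScalarTower R (integralClosure R α.L) V :=
  Subalgebra.isScalarTower_mid (integralClosure R α.L)

/-- A shortcut for instance search. -/
instance isScalarTower_integralClosure_left : IsScalarTower (integralClosure R α.L) α.L V :=
  Subalgebra.isScalarTower_left (integralClosure R α.L)

theorem extendToL_tmul_apply (a : K →ₐ[F] Module.End F V) (h : ∀ x, Commute α.w (a x)) (l : α.L)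
    (x : K) (v : V) : α.extendToL a h (l ⊗ₜ x) v = l • a x v := by
  exact LinearMap.congr_fun (Algebra.TensorProduct.lift_tmul (Algebra.ofId α.L (Module.End α.L V))
    (α.linearize a h) (fun l x => Algebra.commutes l _) l x) v

section ReducedW
variable {α} (hS : S.GenUnit) (hz : IsUnit (1 + α.z))

theorem reduced_fst_gen_apply (v : V) :
    (α.reduced hS hz).fst (S.baseChange α.L hS).gen v = α.fst S.gen v :=
  (α.extendToL_tmul_apply _ _ _ _ _).trans (one_smul _ _)

theorem reduced_fst_σ_gen_apply (v : V) :
    (α.reduced hS hz).fst ((S.baseChange α.L hS).σ (S.baseChange α.L hS).gen) v =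
      α.fst (S.σ S.gen) v :=
  (α.extendToL_tmul_apply _ _ _ _ _).trans (one_smul _ _)

theorem reduced_snd_gen_apply (v : V) :
    (α.reduced hS hz).snd (S.baseChange α.L hS).gen v = α.tilde hz S.gen v :=
  (α.extendToL_tmul_apply _ _ _ _ _).trans (one_smul _ _)

theorem reduced_snd_σ_gen_apply (v : V) :
    (α.reduced hS hz).snd ((S.baseChange α.L hS).σ (S.baseChange α.L hS).gen) v =
      α.tilde hz (S.σ S.gen) v :=
  (α.extendToL_tmul_apply _ _ _ _ _).trans (one_smul _ _)

/-- The product is the inverse of `1 - z²`, which lies in `L`; by finite dimension it is integral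
over `F`, hence a polynomial in `1 - z²`. -/
theorem inverse_mul_inverse_mem_L (hz : IsUnit (1 + α.z)) [FiniteDimensional F V] {v : Module.End F V}
    (hv' : v * (1 - α.z) = 1) : Ring.inverse (1 + α.z) * v ∈ α.L := by
  have h1 : 1 - α.z * α.z ∈ α.L := sub_mem α.L.one_mem α.z_mul_z_mem_L
  refine Algebra.adjoin_le (Set.singleton_subset_iff.2 h1)
    (mem_adjoin_of_isIntegral_of_mul_eq_one ?_ (Algebra.IsIntegral.isIntegral _))
  calc _ = Ring.inverse (1 + α.z) * (v * (1 - α.z)) * (1 + α.z) := by noncomm_ring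
    _ = 1 := by rw [hv', mul_one, Ring.inverse_mul_cancel _ hz]

theorem exists_algebraMap_eq_fst_mul_σ (x : K) : ∃ r : F, algebraMap F _ r = α.fst (x * S.σ x) := by
  obtain ⟨n, hn⟩ := S.exists_norm x
  exact ⟨n, by rw [← AlgHom.commutes α.fst, hn]⟩

theorem exists_algebraMap_eq_fst_sub_sq :
    ∃ r : F, algebraMap F _ r = α.fst ((S.gen - S.σ S.gen) * (S.gen - S.σ S.gen)) := by
  obtain ⟨r, hr⟩ := α.exists_algebraMap_eq_fst_mul_σ (S.gen - S.σ S.gen)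
  -- Since `σ` negates `ζ - σ ζ`, its square is minus its norm.
  refine ⟨-r, ?_⟩
  rw [map_neg, hr, ← map_neg, map_sub, S.σ_σ]
  congr 1; ring

theorem exists_algebraMap_eq_reduced_w [FiniteDimensional F V] {v : Module.End F V}
    (hv' : v * (1 - α.z) = 1) :
    ∃ l : α.L, algebraMap α.L (Module.End α.L V) l = (α.reduced hS hz).w := by
  obtain ⟨n, hn⟩ := α.exists_algebraMap_eq_fst_mul_σ S.gen
  obtain ⟨r, hr⟩ := α.exists_algebraMap_eq_fst_sub_sq
  have hm := α.inverse_mul_inverse_mem_L hz hv'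
  have hl : 2 * α.fst (S.gen * S.σ S.gen) + Ring.inverse (1 + α.z) * v *
      α.fst ((S.gen - S.σ S.gen) * (S.gen - S.σ S.gen)) ∈ α.L := by
    rw [← hn, ← hr, two_mul]
    exact add_mem (add_mem (algebraMap_mem _ _) (algebraMap_mem _ _))
      (mul_mem hm (algebraMap_mem _ _))
  refine ⟨⟨_, hl⟩, LinearMap.ext fun y => ?_⟩
  have h := LinearMap.congr_fun (α.tilde_w hz hv') y
  refine Eq.trans h.symm ?_
  change _ = (α.reduced hS hz).fst (S.baseChange α.L hS).gen
      ((α.reduced hS hz).snd (S.baseChange α.L hS).gen y) +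
    (α.reduced hS hz).snd ((S.baseChange α.L hS).σ (S.baseChange α.L hS).gen)
      ((α.reduced hS hz).fst ((S.baseChange α.L hS).σ (S.baseChange α.L hS).gen) y)
  rw [reduced_snd_gen_apply, reduced_fst_gen_apply, reduced_fst_σ_gen_apply,
    reduced_snd_σ_gen_apply]
  rfl

theorem reduced_z_apply {v : Module.End F V} (hv' : v * (1 - α.z) = 1) (y : V) :
    (α.reduced hS hz).z y = (-(α.z * (Ring.inverse (1 + α.z) * v *
        α.fst ((S.gen - S.σ S.gen) * (S.gen - S.σ S.gen))))) y := by
  rw [← α.tilde_z hz hv']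
  change (α.reduced hS hz).snd (S.baseChange α.L hS).gen ((α.reduced hS hz).fst _ y) -
    (α.reduced hS hz).fst (S.baseChange α.L hS).gen ((α.reduced hS hz).snd _ y) = _
  rw [reduced_snd_gen_apply, reduced_fst_gen_apply, reduced_fst_gen_apply, reduced_snd_gen_apply]
  rfl

/-- The natural map from `L` to the ring `L[w]` of the reduced pair is bijective. -/
theorem algebraMap_reduced_L_bijective [FiniteDimensional F V] {v : Module.End F V}
    (hv' : v * (1 - α.z) = 1) :
    Function.Bijective (algebraMap α.L (α.reduced hS hz).L) := by
  constructor
  · intro l l' h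
    refine Subtype.ext (LinearMap.ext fun y => ?_)
    exact LinearMap.congr_fun (congrArg Subtype.val h) y
  · rintro ⟨x, hx⟩
    obtain ⟨l, hl⟩ := α.exists_algebraMap_eq_reduced_w hS hz hv'
    -- The reduced `w` is itself a scalar from `L`, so it generates nothing beyond `L`.
    have : x ∈ (⊥ : Subalgebra α.L (Module.End α.L V)) :=
      Algebra.adjoin_le (Set.singleton_subset_iff.2 (hl ▸ algebraMap_mem _ l)) hx
    obtain ⟨m, hm⟩ := Algebra.mem_bot.1 this
    exact ⟨m, Subtype.ext hm⟩

end ReducedW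

section Lattices

theorem finite_integralClosure_of_isMaximal (hmax : α.IsMaximal R) :
    Module.Finite R (integralClosure R α.L) := by
  have h := (isIntegral_of_adjoin_eq_integralClosure hmax).fg_adjoin_singleton
  rw [hmax] at h
  exact Module.Finite.iff_fg.2 h

variable {α}

theorem exists_integral_multiple [FiniteDimensional F V] [IsDomain R] [IsFractionRing R F]
    (l : α.L) : ∃ r : R, algebraMap R F r ≠ 0 ∧ IsIntegral R (r • l) := by
  have hl : IsIntegral F l :=
    (isIntegral_algHom_iff α.L.val Subtype.val_injective).1 (Algebra.IsIntegral.isIntegral _)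
  obtain ⟨m, hm⟩ := hl.exists_multiple_integral_of_isLocalization (nonZeroDivisors R) l
  exact ⟨m, IsFractionRing.to_map_ne_zero_of_mem_nonZeroDivisors m.2, hm⟩

theorem isLattice_restrictScalars_iff_of_isMaximal [FiniteDimensional F V] [IsDomain R]
    [IsFractionRing R F] (hmax : α.IsMaximal R) (M : Submodule (integralClosure R α.L) V) :
    (M.restrictScalars R).IsLattice F ↔ M.IsLattice α.L :=
  have := α.finite_integralClosure_of_isMaximal hmax
  Submodule.isLattice_restrictScalars_iff (fun l => by
    obtain ⟨r, hr, hl⟩ := α.exists_integral_multiple (R := R) l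
    exact ⟨r, hr, ⟨r • l, hl⟩, rfl⟩) M

theorem coe_mem_endStabilizer (M : Submodule (integralClosure R α.L) V) {l : α.L}
    (hl : IsIntegral R l) :
    (l : Module.End F V) ∈ (M.restrictScalars R).endStabilizer := fun _ hv =>
  M.smul_mem (⟨l, hl⟩ : integralClosure R α.L) hv

theorem mem_stableLattices_iff {E : Type*} [CommRing E] [Algebra R E] [Module E V]
    [IsScalarTower R E V] [Algebra E K] [Algebra R K] [IsScalarTower R E K]
    {a : K →ₐ[E] Module.End E V} {Λ : Submodule R V} :
    Λ ∈ stableLattices R E a ↔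
      Λ.IsLattice E ∧ ∀ x : K, IsIntegral R x → a x ∈ Λ.endStabilizer := by
  simp only [stableLattices, Set.mem_ofPred_eq, isInt_iff_isIntegral]; rfl

/-- Because `ζ - σ ζ` is an integral unit, the integers of `L ⊗ K` are `O_L + O_L (1 ⊗ ζ)`. On an
`O_L`-module, stability under them reduces to stability under `O_K`. -/
theorem mem_stableLattices_extendToL_iff [Nontrivial K] [Algebra R K] [IsScalarTower R F K]
    (hS : S.GenUnit) (hg : IsIntegral R S.gen) {e : K} (he : (S.gen - S.σ S.gen) * e = 1)
    (hei : IsIntegral R e) {a : K →ₐ[F] Module.End F V} {h : ∀ x, Commute α.w (a x)}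
    {M : Submodule (integralClosure R α.L) V} :
    M ∈ stableLattices (integralClosure R α.L) α.L (α.extendToL a h) ↔ M.IsLattice α.L ∧
      ∀ x : K, IsIntegral R x → a x ∈ (M.restrictScalars R).endStabilizer := by
  rw [mem_stableLattices_iff]
  have hr : ∀ x : K, IsIntegral R x →
      IsIntegral (integralClosure R α.L) ((1 : α.L) ⊗ₜ[F] x) := fun x hx =>
    (IsIntegral.map ((Algebra.TensorProduct.includeRight : K →ₐ[F] α.L ⊗[F] K).restrictScalars R)
      hx).tower_top
  refine and_congr_right fun _ => ⟨fun H x hx v hv => ?_, fun H x hx v hv => ?_⟩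
  · have := H _ (hr x hx) v hv
    rwa [extendToL_tmul_apply, one_smul] at this
  · obtain ⟨r, s, hr', hs', rfl⟩ := (S.baseChange α.L hS).exists_integral_coords
      (R := integralClosure R α.L) (FaithfulSMul.algebraMap_injective _ _) (hr _ hg)
      (e := 1 ⊗ₜ e) (by
        change ((1 : α.L) ⊗ₜ[F] S.gen - (1 : α.L) ⊗ₜ[F] S.σ S.gen) * _ = 1
        rw [← TensorProduct.tmul_sub, Algebra.TensorProduct.tmul_mul_tmul, he, one_mul]; rfl)
      (hr _ hei) hx
    have hr'' : IsIntegral R r := isIntegral_trans r hr'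
    have hs'' : IsIntegral R s := isIntegral_trans s hs'
    have e1 : α.extendToL a h (algebraMap α.L _ r + s • (S.baseChange α.L hS).gen) v =
        r • v + s • a S.gen v := by
      refine (AlgHom.algebraMap_add_smul_apply (α.extendToL a h) r s _ v).trans ?_
      rw [show α.extendToL a h (S.baseChange α.L hS).gen v = a S.gen v from
        (extendToL_tmul_apply α a h _ _ _).trans (one_smul _ _)]
    rw [e1]
    exact M.add_mem (M.smul_mem (⟨r, hr''⟩ : integralClosure R α.L) hv)
      (M.smul_mem (⟨s, hs''⟩ : integralClosure R α.L) (H _ hg v hv))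

end Lattices
end QuadPair

/-! ### Matching lattices, tori and transfer factors -/

namespace QuadPair
section Comparison
open scoped Pointwise
variable {R E V K K' : Type*} [CommRing R] [CommRing E] [Algebra R E]
  [AddCommGroup V] [Module E V] [Module R V] [IsScalarTower R E V]
  [CommRing K] [CommRing K'] [Algebra E K] [Algebra E K']
  {S : QuadAlg E K} {S' : QuadAlg E K'} {α : QuadPair S S' (Module.End E V)}
  {R₁ E₁ V₁ K₁ K₁' : Type*} [CommRing R₁] [CommRing E₁] [Algebra R₁ E₁]
  [AddCommGroup V₁] [Module E₁ V₁] [Module R₁ V₁] [IsScalarTower R₁ E₁ V₁]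
  [CommRing K₁] [CommRing K₁'] [Algebra E₁ K₁] [Algebra E₁ K₁']
  {S₁ : QuadAlg E₁ K₁} {S₁' : QuadAlg E₁ K₁'} {α₁ : QuadPair S₁ S₁' (Module.End E₁ V₁)}

/-- Orbital integrals of the unit function agree when the common lattices, the acting tori and
their maximal compact subgroups correspond. -/
theorem orbitalIntegral_unitFunction_congr (φ : α.CommonLattices R ≃ α₁.CommonLattices R₁)
    (e : (α.L)ˣ ≃* (α₁.L)ˣ)
    (hφ : ∀ (g : (α.L)ˣ) (Λ Λ' : α.CommonLattices R),
      e g • (φ Λ).1 = (φ Λ').1 ↔ g • Λ.1 = Λ'.1)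
    (he : (intUnits R E α.L).map e.toMonoidHom = intUnits R₁ E₁ α₁.L)
    {Ω : Submodule R V → ℂ} {Ω₁ : Submodule R₁ V₁ → ℂ}
    (hΩ : ∀ (g : (α.L)ˣ) (Λ : Submodule R V), Ω (g • Λ) = Ω Λ)
    (hΩ₁ : ∀ (g : (α₁.L)ˣ) (Λ : Submodule R₁ V₁), Ω₁ (g • Λ) = Ω₁ Λ)
    (h : ∀ Λ : α.CommonLattices R, Ω₁ (φ Λ).1 = Ω Λ.1) :
    α.orbitalIntegral R (unitFunction R) Ω = α₁.orbitalIntegral R₁ (unitFunction R₁) Ω₁ := by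
  rw [orbitalIntegral_unitFunction α hΩ, orbitalIntegral_unitFunction α₁ hΩ₁]
  have hrel : ∀ Λ Λ' : α.CommonLattices R,
      (α.commonSetoid R).r Λ Λ' ↔ (α₁.commonSetoid R₁).r (φ Λ) (φ Λ') := by
    intro Λ Λ'
    constructor
    · rintro ⟨g, hg⟩
      exact ⟨e g, (hφ g Λ' Λ).2 hg⟩
    · rintro ⟨g, hg⟩
      obtain ⟨g, rfl⟩ := e.surjective g
      exact ⟨g, (hφ g Λ' Λ).1 hg⟩
  let ψ : Quotient (α.commonSetoid R) ≃ Quotient (α₁.commonSetoid R₁) := Quotient.congr φ hrel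
  rw [← ψ.tsum_eq]
  refine tsum_congr fun c => ?_
  obtain ⟨g, hg⟩ : (α₁.commonSetoid R₁).r (ψ c).out (φ c.out) := by
    refine Quotient.exact ?_
    rw [Quotient.out_eq]
    conv_lhs => rw [← Quotient.out_eq c]
    rfl
  have hg' : (ψ c).out.1 = g • (φ c.out).1 := hg.symm
  -- The case `Λ' = Λ` of `hφ`.
  have hstab : MulAction.stabilizer (α.L)ˣ c.out.1 =
      (MulAction.stabilizer (α₁.L)ˣ (φ c.out).1).comap e.toMonoidHom := by
    ext x
    exact (hφ x c.out c.out).symm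
  rw [hg', hΩ₁, stabilizer_units_smul, h, hstab, Subgroup.relIndex_comap, he]

end Comparison

section Correspondence
variable {R F V K K' : Type*} [CommRing R] [IsIntegrallyClosed R] [Field F]
  [Algebra R F] [IsFractionRing R F] [AddCommGroup V] [Module F V] [FiniteDimensional F V]
  [Module R V] [IsScalarTower R F V] [CommRing K] [CommRing K'] [Nontrivial K] [Nontrivial K']
  [Algebra F K] [Algebra F K'] [Algebra R K] [IsScalarTower R F K] [Algebra R K']
  [IsScalarTower R F K'] {S : QuadAlg F K} {S' : QuadAlg F K'}

theorem _root_.QuadAlg.adjoin_gen_eq_integralClosure (hg : IsIntegral R S.gen)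
    (he : ∃ e, (S.gen - S.σ S.gen) * e = 1 ∧ IsIntegral R e) :
    Algebra.adjoin R {S.gen} = integralClosure R K := by
  obtain ⟨e, he, hei⟩ := he
  refine le_antisymm (Algebra.adjoin_le (Set.singleton_subset_iff.2 hg)) fun x hx => ?_
  obtain ⟨r, s, hr, hs, rfl⟩ :=
    S.exists_integral_coords (algebraMap F K).injective hg he hei hx
  obtain ⟨r, rfl⟩ := IsIntegrallyClosed.algebraMap_eq_of_integral hr
  obtain ⟨s, rfl⟩ := IsIntegrallyClosed.algebraMap_eq_of_integral hs
  rw [← IsScalarTower.algebraMap_apply, algebraMap_smul]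
  exact add_mem (algebraMap_mem _ _) (Subalgebra.smul_mem _ (Algebra.self_mem_adjoin_singleton R _) _)

variable [IsDomain R] {α : QuadPair S S' (Module.End F V)} (hS : S.GenUnit) (hz : IsUnit (1 + α.z))

/-- This is `order_contains_iff` for the order preserving `M`. Its clause on `O_L` is automatic for
an `O_L`-module, and stability under `α̃` is tested on `ζ` because `ζ` generates `O_K`. -/
theorem restrictScalars_mem_commonLattices_iff (hmax : α.IsMaximal R)
    (hm : IsMaximalOrderUnit R (1 - α.z)) (hg : IsIntegral R S.gen)
    (he : ∃ e, (S.gen - S.σ S.gen) * e = 1 ∧ IsIntegral R e)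
    (hK' : Algebra.adjoin R {S'.gen} = integralClosure R K')
    (M : Submodule (integralClosure R α.L) V) :
    (M.restrictScalars R ∈ stableLattices R F α.fst ∧
      M.restrictScalars R ∈ stableLattices R F α.snd) ↔
    (M ∈ stableLattices (integralClosure R α.L) α.L (α.reduced hS hz).fst ∧
      M ∈ stableLattices (integralClosure R α.L) α.L (α.reduced hS hz).snd) := by
  have hK := QuadAlg.adjoin_gen_eq_integralClosure hg he
  obtain ⟨e, he, hei⟩ := he
  obtain ⟨hi, v, -, hv, hvi⟩ := hm.exists_integral_inverse
  have key := order_contains_iff (B := (M.restrictScalars R).endStabilizer) hz hmax hg he hei hK'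
    hi hv hvi
  have h1 : M ∈ stableLattices (integralClosure R α.L) α.L (α.reduced hS hz).fst ↔ _ :=
    mem_stableLattices_extendToL_iff hS hg he hei
  have h2 : M ∈ stableLattices (integralClosure R α.L) α.L (α.reduced hS hz).snd ↔ _ :=
    mem_stableLattices_extendToL_iff hS hg he hei
  rw [h1, h2, mem_stableLattices_iff, mem_stableLattices_iff,
    isLattice_restrictScalars_iff_of_isMaximal hmax, ← and_and_left, ← and_and_left, key]
  refine and_congr_right fun _ => ⟨fun h => ⟨h.2.1, fun x hx => ?_⟩, fun h => ⟨fun l hl => ?_, h.1,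
    h.2 _ hg⟩⟩
  · exact AlgHom.map_mem_of_adjoin_eq_integralClosure ((α.tilde hz).restrictScalars R) hK h.2.2 hx
  · exact coe_mem_endStabilizer M hl

/-- The common lattices of a pair, as modules over `O_L`, are those of its reduced pair. -/
def commonLatticesEquiv (hmax : α.IsMaximal R)
    (hm : IsMaximalOrderUnit R (1 - α.z)) (hg : IsIntegral R S.gen)
    (he : ∃ e, (S.gen - S.σ S.gen) * e = 1 ∧ IsIntegral R e)
    (hK' : Algebra.adjoin R {S'.gen} = integralClosure R K') :
    α.CommonLattices R ≃ (α.reduced hS hz).CommonLattices (integralClosure R α.L) where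
  toFun Λ :=
    let M : Submodule (integralClosure R α.L) V :=
      { Λ.1 with
        smul_mem' := fun l v hv => by
          obtain ⟨h1, h2⟩ := Λ.2
          rw [mem_stableLattices_iff] at h1 h2
          exact coe_mem_of_isMaximal hmax
            (w_mem h1.2 h2.2 hg (isIntegral_of_adjoin_eq_integralClosure hK')) l.2 v hv }
    ⟨M, (restrictScalars_mem_commonLattices_iff hS hz hmax hm hg he hK' M).1 Λ.2⟩
  invFun M := ⟨M.1.restrictScalars R,
    (restrictScalars_mem_commonLattices_iff hS hz hmax hm hg he hK' M.1).2 M.2⟩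
  left_inv _ := rfl
  right_inv _ := rfl

end Correspondence
end QuadPair

theorem Submodule.map_eq_self_of_mul_eq_one {R F V : Type*} [CommRing R] [CommRing F]
    [Algebra R F] [AddCommGroup V] [Module F V] [Module R V] [IsScalarTower R F V]
    {Λ : Submodule R V} {c c' : Module.End F V}
    (hc : c ∈ Λ.endStabilizer) (hc' : c' ∈ Λ.endStabilizer) (h : c * c' = 1) :
    Λ.toAddSubgroup.map (c : V →ₗ[F] V).toAddMonoidHom = Λ.toAddSubgroup := by
  ext y
  constructor
  · rintro ⟨x, hx, rfl⟩
    exact hc x hx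
  · exact fun hy => ⟨c' y, hc' y hy, LinearMap.congr_fun h y⟩

namespace QuadPair
section Reduced
open scoped Pointwise
variable {R F V K K' : Type*} [CommRing R] [Field F]
  [Algebra R F] [AddCommGroup V] [Module F V] [FiniteDimensional F V]
  [Module R V] [IsScalarTower R F V] [CommRing K] [CommRing K']
  [Algebra F K] [Algebra F K'] {S : QuadAlg F K} {S' : QuadAlg F K'}
  {α : QuadPair S S' (Module.End F V)} (hS : S.GenUnit) (hz : IsUnit (1 + α.z))
  {v : Module.End F V} (hv' : v * (1 - α.z) = 1)

/-- The isomorphism of `L` with the ring `L[w]` of the reduced pair. -/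
noncomputable def reducedLEquiv : α.L ≃+* (α.reduced hS hz).L :=
  RingEquiv.ofBijective (algebraMap α.L (α.reduced hS hz).L)
    (algebraMap_reduced_L_bijective hS hz hv')

/-- Integrality over `O_L` and over `O_F` coincide by transitivity, so both tori have the same
normalizing subgroup. -/
theorem isInt_reducedLEquiv_iff (l : α.L) :
    IsInt (integralClosure R α.L) α.L (reducedLEquiv hS hz hv' l) ↔ IsInt R F l := by
  rw [isInt_iff_isIntegral (R := R) (E := F)]
  have hinj : Function.Injective (algebraMap α.L (α.reduced hS hz).L) :=
    (algebraMap_reduced_L_bijective hS hz hv').1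
  constructor
  · intro h
    have h1 : IsIntegral (integralClosure R α.L) l := by
      obtain ⟨p, hp, h0⟩ := h
      refine ⟨p, hp, hinj ?_⟩
      rw [Polynomial.hom_eval₂, map_zero]
      exact h0
    exact isIntegral_trans l h1
  · intro h
    exact (RingHom.isIntegralElem_map _ (x := (⟨l, h⟩ : integralClosure R α.L)))

theorem map_intUnits_reducedLEquiv :
    (intUnits R F α.L).map (Units.mapEquiv (reducedLEquiv hS hz hv').toMulEquiv).toMonoidHom =
      intUnits (integralClosure R α.L) α.L (α.reduced hS hz).L := by
  ext u
  obtain ⟨g, rfl⟩ := (Units.mapEquiv (reducedLEquiv hS hz hv').toMulEquiv).surjective u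
  have h1 : g ∈ intUnits R F α.L ↔ Units.mapEquiv (reducedLEquiv hS hz hv').toMulEquiv g ∈
      intUnits (integralClosure R α.L) α.L (α.reduced hS hz).L :=
    and_congr (isInt_reducedLEquiv_iff hS hz hv' _).symm
      (isInt_reducedLEquiv_iff hS hz hv' _).symm
  rw [← h1]
  exact Subgroup.mem_map_iff_mem (Units.mapEquiv (reducedLEquiv hS hz hv').toMulEquiv).injective

theorem reducedLEquiv_smul_eq_iff (g : (α.L)ˣ) (M M' : Submodule (integralClosure R α.L) V) :
    Units.mapEquiv (reducedLEquiv hS hz hv').toMulEquiv g • M = M' ↔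
      g • M.restrictScalars R = M'.restrictScalars R := by
  refine SetLike.ext'_iff.trans (Iff.trans ?_ (SetLike.ext'_iff (p := g • M.restrictScalars R)
    (q := M'.restrictScalars R)).symm)
  exact Iff.rfl

include hv' in
-- The reduced `z` is `z * c`, where `c` maps `M` onto itself and commutes with `α₁(ζ)`; so it maps
-- `ζ M` onto `z ζ M`, while the lattices `ζ M` and `σ(ζ) M` are unchanged.
theorem transferFactor_reduced {e : K} (he : (S.gen - S.σ S.gen) * e = 1)
    (M : Submodule (integralClosure R α.L) V)
    (hd : α.fst (S.gen - S.σ S.gen) ∈ (M.restrictScalars R).endStabilizer)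
    (hed : α.fst e ∈ (M.restrictScalars R).endStabilizer)
    (hzM : α.z ∈ (M.restrictScalars R).endStabilizer)
    (hu : Ring.inverse (1 + α.z) ∈ (M.restrictScalars R).endStabilizer) (q : ℕ) (s : ℂ) :
    (α.reduced hS hz).transferFactor (integralClosure R α.L) q M s =
      α.transferFactor R q (M.restrictScalars R) s := by
  have h1 : α.fst (S.gen - S.σ S.gen) * α.fst e = 1 := by rw [← map_mul, he, map_one]
  have hvM : v ∈ (M.restrictScalars R).endStabilizer := by
    have : v = α.fst (S.gen - S.σ S.gen) * Ring.inverse (1 + α.z) * α.fst e := by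
      rw [fst_sub_mul_inverse α hz hv', mul_assoc, h1, mul_one]
    rw [this]
    exact mul_mem (mul_mem hd hu) hed
  set c : Module.End F V := -(Ring.inverse (1 + α.z) * v *
    α.fst ((S.gen - S.σ S.gen) * (S.gen - S.σ S.gen))) with hc
  have hcM : c ∈ (M.restrictScalars R).endStabilizer := by
    rw [hc, map_mul]
    exact neg_mem (mul_mem (mul_mem hu hvM) (mul_mem hd hd))
  -- This is the explicit inverse of `c`, written without inverses of `1 ± z`.
  have hcM' : -(α.fst e * α.fst e * (1 - α.z) * (1 + α.z)) ∈
      (M.restrictScalars R).endStabilizer :=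
    neg_mem (mul_mem (mul_mem (mul_mem hed hed) (sub_mem (one_mem _) hzM))
      (add_mem (one_mem _) hzM))
  have hcc : c * -(α.fst e * α.fst e * (1 - α.z) * (1 + α.z)) = 1 := by
    have h2 : α.fst ((S.gen - S.σ S.gen) * (S.gen - S.σ S.gen)) * (α.fst e * α.fst e) = 1 := by
      rw [← map_mul, ← map_mul, mul_mul_mul_comm, he, one_mul, map_one]
    calc _ = Ring.inverse (1 + α.z) * (v *
          (α.fst ((S.gen - S.σ S.gen) * (S.gen - S.σ S.gen)) * (α.fst e * α.fst e)) *
          (1 - α.z)) * (1 + α.z) := by rw [hc]; noncomm_ring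
      _ = 1 := by rw [h2, mul_one, hv', mul_one, Ring.inverse_mul_cancel _ hz]
  have hca : Commute c (α.fst S.gen) := by
    refine Commute.neg_left (Commute.mul_left
      (α.L_comm (α.w_comm _) (α.inverse_mul_inverse_mem_L hz hv')) ?_)
    rw [Commute, SemiconjBy, ← map_mul, ← map_mul, mul_comm]
  have hΛ := Submodule.map_eq_self_of_mul_eq_one hcM hcM' hcc
  set Λ := (M.restrictScalars R).toAddSubgroup with hΛdef
  have hp : M.toAddSubgroup.map ((α.reduced hS hz).fst (S.baseChange α.L hS).gen :
      V →ₗ[α.L] V).toAddMonoidHom = Λ.map (α.fst S.gen : V →ₗ[F] V).toAddMonoidHom :=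
    congrArg (fun f => AddSubgroup.map f Λ)
      (AddMonoidHom.ext fun y => reduced_fst_gen_apply hS hz y)
  have hm : M.toAddSubgroup.map ((α.reduced hS hz).fst
      ((S.baseChange α.L hS).σ (S.baseChange α.L hS).gen) :
      V →ₗ[α.L] V).toAddMonoidHom = Λ.map (α.fst (S.σ S.gen) : V →ₗ[F] V).toAddMonoidHom :=
    congrArg (fun f => AddSubgroup.map f Λ)
      (AddMonoidHom.ext fun y => reduced_fst_σ_gen_apply hS hz y)
  have hzz : (Λ.map (α.fst S.gen : V →ₗ[F] V).toAddMonoidHom).map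
      ((α.reduced hS hz).z : V →ₗ[α.L] V).toAddMonoidHom =
      (Λ.map (α.fst S.gen : V →ₗ[F] V).toAddMonoidHom).map
        (α.z : V →ₗ[F] V).toAddMonoidHom := by
    conv_rhs => rw [← hΛ]
    rw [AddSubgroup.map_map, AddSubgroup.map_map, AddSubgroup.map_map]
    refine congrArg (fun f => AddSubgroup.map f Λ) (AddMonoidHom.ext fun y => ?_)
    refine (reduced_z_apply hS hz hv' (α.fst S.gen y)).trans ?_
    rw [← mul_neg, ← hc]
    exact congrArg α.z (LinearMap.congr_fun hca y)
  simp only [transferFactor]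
  rw [hp, hm, hzz]

end Reduced

/-! ### The identities for a general pair -/

section Main
variable {R F V K K' : Type*} [CommRing R] [IsDomain R] [IsIntegrallyClosed R] [Field F]
  [Algebra R F] [IsFractionRing R F] [AddCommGroup V] [Module F V] [FiniteDimensional F V]
  [Module R V] [IsScalarTower R F V] [CommRing K] [CommRing K'] [Nontrivial K] [Nontrivial K']
  [Algebra F K] [Algebra F K'] [Algebra R K] [IsScalarTower R F K] [Algebra R K']
  [IsScalarTower R F K'] {S : QuadAlg F K} {S' : QuadAlg F K'}
  {α : QuadPair S S' (Module.End F V)} (hS : S.GenUnit) (hz : IsUnit (1 + α.z))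

open scoped Pointwise in
theorem orbitalIntegral_reduced (hmax : α.IsMaximal R)
    (hm : IsMaximalOrderUnit R (1 - α.z)) (hg : IsIntegral R S.gen)
    (he : ∃ e, (S.gen - S.σ S.gen) * e = 1 ∧ IsIntegral R e)
    (hK' : Algebra.adjoin R {S'.gen} = integralClosure R K')
    {Ω : Submodule R V → ℂ} {Ω₁ : Submodule (integralClosure R α.L) V → ℂ}
    (hΩ : ∀ (g : (α.L)ˣ) (Λ : Submodule R V), Ω (g • Λ) = Ω Λ)
    (hΩ₁ : ∀ (g : ((α.reduced hS hz).L)ˣ) (M : Submodule (integralClosure R α.L) V),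
      Ω₁ (g • M) = Ω₁ M)
    (h : ∀ M : Submodule (integralClosure R α.L) V,
      M.restrictScalars R ∈ stableLattices R F α.fst →
      M.restrictScalars R ∈ stableLattices R F α.snd → Ω₁ M = Ω (M.restrictScalars R)) :
    α.orbitalIntegral R (unitFunction R) Ω =
      (α.reduced hS hz).orbitalIntegral (integralClosure R α.L)
        (unitFunction (integralClosure R α.L)) Ω₁ := by
  obtain ⟨-, v, -, hv', -⟩ := hm.exists_integral_inverse
  refine orbitalIntegral_unitFunction_congr
    (commonLatticesEquiv hS hz hmax hm hg he hK')
    (Units.mapEquiv (reducedLEquiv hS hz hv').toMulEquiv)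
    (fun g Λ Λ' => reducedLEquiv_smul_eq_iff hS hz hv' g _ _)
    (map_intUnits_reducedLEquiv hS hz hv') hΩ hΩ₁ fun Λ => h _ Λ.2.1 Λ.2.2

/-- `Orb(𝟏, α) = Orb(𝟏, (α_{1L}, α̃))`. -/
theorem orb_eq_orbReduced (hmax : α.IsMaximal R)
    (hm : IsMaximalOrderUnit R (1 - α.z)) (hg : IsIntegral R S.gen)
    (he : ∃ e, (S.gen - S.σ S.gen) * e = 1 ∧ IsIntegral R e)
    (hK' : Algebra.adjoin R {S'.gen} = integralClosure R K') :
    α.orb R = α.orbReduced R hS hz :=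
  orbitalIntegral_reduced hS hz hmax hm hg he hK' (fun _ _ => rfl) (fun _ _ => rfl)
    fun _ _ _ => rfl

/-- `Orb(𝟏, β, s) = Orb(𝟏, (β_{1L}, β̃), s)`. -/
theorem orbTwisted_eq_orbTwistedReduced (hmax : α.IsMaximal R)
    (hm : IsMaximalOrderUnit R (1 - α.z)) (hg : IsIntegral R S.gen)
    (he : ∃ e, (S.gen - S.σ S.gen) * e = 1 ∧ IsIntegral R e)
    (hK' : Algebra.adjoin R {S'.gen} = integralClosure R K') (q : ℕ) (s : ℂ) :
    α.orbTwisted R q s = α.orbTwistedReduced R hS hz q s := by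
  refine orbitalIntegral_reduced hS hz hmax hm hg he hK'
    (Ω := fun Λ => α.transferFactor R q Λ s)
    (Ω₁ := fun M => (α.reduced hS hz).transferFactor (integralClosure R α.L) q M s)
    (fun g Λ => transferFactor_units_smul α q g Λ s)
    (fun g M => transferFactor_units_smul (α.reduced hS hz) q g M s) fun M h1 h2 => ?_
  obtain ⟨-, v, -, hv', hvi⟩ := hm.exists_integral_inverse
  obtain ⟨e, he, hei⟩ := he
  rw [mem_stableLattices_iff] at h1 h2
  have hzM := z_mem h1.2 h2.2 hg (isIntegral_of_adjoin_eq_integralClosure hK')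
  have hσ : IsIntegral R (S.σ S.gen) := hg.map ((S.σ : K →ₐ[F] K).restrictScalars R)
  refine transferFactor_reduced hS hz hv' he M (h1.2 _ (hg.sub hσ)) (h1.2 _ hei) hzM ?_ q s
  exact Algebra.adjoin_le (Set.singleton_subset_iff.2 (add_mem (one_mem _) hzM))
    (mem_adjoin_of_isIntegral_of_mul_eq_one (Ring.inverse_mul_cancel _ hz)
      (isIntegral_inverse_one_add_z hz he hv' hvi))

end Main
end QuadPair

/-! ### Integral generators of `K₀` and `K₃` -/

namespace QuadAlg

theorem exists_algebraMap_eq_of_isIntegral {R F K : Type*} [CommRing R] [IsIntegrallyClosed R]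
    [Field F] [Algebra R F] [IsFractionRing R F] [CommRing K] [Nontrivial K] [Algebra F K]
    [Algebra R K] [IsScalarTower R F K] {f : F} (hf : IsIntegral R (algebraMap F K f)) :
    ∃ r, algebraMap R F r = f :=
  IsIntegrallyClosed.algebraMap_eq_of_integral
    ((isIntegral_algHom_iff (IsScalarTower.toAlgHom R F K) (algebraMap F K).injective).1 hf)

theorem exists_eq_add_smul_of_mem_adjoin {R K : Type*} [CommRing R] [CommRing K] [Algebra R K]
    {g : K} {t n : R} (hg : g * g = t • g - n • 1) {y : K} (hy : y ∈ Algebra.adjoin R {g}) :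
    ∃ r s : R, y = r • 1 + s • g := by
  induction hy using Algebra.adjoin_induction with
  | mem y hy => obtain rfl := hy; exact ⟨0, 1, by simp⟩
  | algebraMap r => exact ⟨r, 0, by simp [Algebra.algebraMap_eq_smul_one]⟩
  | add y y' _ _ hy hy' =>
    obtain ⟨r, s, rfl⟩ := hy
    obtain ⟨r', s', rfl⟩ := hy'
    exact ⟨r + r', s + s', by module⟩
  | mul y y' _ _ hy hy' =>
    obtain ⟨r, s, rfl⟩ := hy
    obtain ⟨r', s', rfl⟩ := hy'
    refine ⟨r * r' - s * s' * n, r * s' + s * r' + s * s' * t, ?_⟩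
    simp only [add_mul, mul_add, smul_mul_assoc, mul_smul_comm, one_mul, mul_one, hg]
    module

theorem isIntegral_σ {R F K : Type*} [CommRing R] [CommRing F] [CommRing K] [Algebra R F]
    [Algebra F K] [Algebra R K] [IsScalarTower R F K] (S : QuadAlg F K) {x : K}
    (hx : IsIntegral R x) : IsIntegral R (S.σ x) :=
  hx.map ((S.σ : K →ₐ[F] K).restrictScalars R)

variable {R F K₁ K₂ : Type*} [CommRing R] [Field F] [Field K₁] [Field K₂] [Algebra R F]
  [Algebra F K₁] [Algebra F K₂] [Algebra R K₁] [IsScalarTower R F K₁]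
  {S₁ : QuadAlg F K₁} (S₂ : QuadAlg F K₂)

section Units
variable (hζ : IsIntegral R S₁.gen) (hu : S₁.GenUnit)
  (hu' : IsIntegral R ((S₁.gen - S₁.σ S₁.gen) * (S₁.gen + S₁.σ S₁.gen))⁻¹)
include hζ hu hu'

theorem isIntegral_inv_gen_sub : IsIntegral R (S₁.gen - S₁.σ S₁.gen)⁻¹ := by
  have h := hu'.mul (hζ.add (S₁.isIntegral_σ hζ))
  rwa [mul_inv, mul_assoc, inv_mul_cancel₀ (gen_add_ne_zero hu), mul_one] at h

theorem isIntegral_inv_gen_add : IsIntegral R (S₁.gen + S₁.σ S₁.gen)⁻¹ := by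
  have h := hu'.mul (hζ.sub (S₁.isIntegral_σ hζ))
  rwa [mul_inv, mul_right_comm, inv_mul_cancel₀ (gen_sub_ne_zero hu), one_mul] at h

end Units

theorem isIntegral_fixedSub_iff {S₂ : QuadAlg F K₂} {x : S₁.fixedSub S₂} :
    IsIntegral R x ↔ IsIntegral R (x : K₁ ⊗[F] K₂) :=
  (isIntegral_algHom_iff ((S₁.fixedSub S₂).val.restrictScalars R) Subtype.val_injective).symm

variable [Algebra R K₂] [IsScalarTower R F K₂]

theorem isIntegral_tmul {a : K₁} {b : K₂} (ha : IsIntegral R a) (hb : IsIntegral R b) :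
    IsIntegral R (a ⊗ₜ[F] b) := by
  have h1 : IsIntegral R (a ⊗ₜ[F] (1 : K₂)) := IsIntegral.map
    ((Algebra.TensorProduct.includeLeft : K₁ →ₐ[F] K₁ ⊗[F] K₂).restrictScalars R) ha
  have h2 : IsIntegral R ((1 : K₁) ⊗ₜ[F] b) := IsIntegral.map
    ((Algebra.TensorProduct.includeRight : K₂ →ₐ[F] K₁ ⊗[F] K₂).restrictScalars R) hb
  simpa using h1.mul h2

theorem isIntegral_quad₀_gen (hζ : IsIntegral R S₁.gen) (hu : S₁.GenUnit)
    (hu' : IsIntegral R ((S₁.gen - S₁.σ S₁.gen) * (S₁.gen + S₁.σ S₁.gen))⁻¹) :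
    IsIntegral R (quad₀ hu).gen := by
  have hσ := S₁.isIntegral_σ hζ
  have h : (S₁.gen - S₁.σ S₁.gen) * (S₁.gen + S₁.σ S₁.gen) = S₁.gen ^ 2 - S₁.σ S₁.gen ^ 2 := by
    ring
  rw [h] at hu'
  rw [isIntegral_fixedSub_iff]
  change IsIntegral R (_ ⊗ₜ[F] _ - _ ⊗ₜ[F] _)
  rw [div_eq_mul_inv, div_eq_mul_inv]
  exact (isIntegral_tmul (hζ.mul hu') hζ).sub (isIntegral_tmul (hσ.mul hu') hσ)

/-- With `d = ζ₁ - σ ζ₁`, the difference is `d⁻¹ ⊗ d`, and `d²` lies in `F`, so it passes across the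
tensor sign and cancels. Thus the difference is its own inverse. -/
theorem quad₀_gen_sub_mul_self (h : S₁.GenUnit) :
    ((quad₀ h).gen - (quad₀ h).σ (quad₀ h).gen) *
      ((quad₀ h).gen - (quad₀ h).σ (quad₀ h).gen) = 1 := by
  have hd := gen_sub_ne_zero h
  have ht := gen_add_ne_zero h
  have hg : S₁.gen ^ 2 - S₁.σ S₁.gen ^ 2 ≠ 0 := by
    rw [show S₁.gen ^ 2 - S₁.σ S₁.gen ^ 2 =
      (S₁.gen - S₁.σ S₁.gen) * (S₁.gen + S₁.σ S₁.gen) by ring]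
    exact h.ne_zero
  refine Subtype.ext ?_
  have key : ((S₁.gen₀ - S₁.fixedEquiv S₁ S₁.gen₀ : S₁.fixedSub S₁) : K₁ ⊗[F] K₁) =
      (S₁.gen - S₁.σ S₁.gen)⁻¹ ⊗ₜ (S₁.gen - S₁.σ S₁.gen) := by
    change ((S₁.gen / (S₁.gen ^ 2 - S₁.σ S₁.gen ^ 2)) ⊗ₜ[F] S₁.gen -
      (S₁.σ S₁.gen / (S₁.gen ^ 2 - S₁.σ S₁.gen ^ 2)) ⊗ₜ[F] S₁.σ S₁.gen) -
      S₁.leftHom ((S₁.gen / (S₁.gen ^ 2 - S₁.σ S₁.gen ^ 2)) ⊗ₜ[F] S₁.gen -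
      (S₁.σ S₁.gen / (S₁.gen ^ 2 - S₁.σ S₁.gen ^ 2)) ⊗ₜ[F] S₁.σ S₁.gen) = _
    simp only [leftHom, map_sub, Algebra.TensorProduct.map_tmul, AlgHom.id_apply,
      AlgEquiv.coe_toAlgHom, map_div₀, map_pow, S₁.σ_σ]
    have hinv : (S₁.gen - S₁.σ S₁.gen)⁻¹ = S₁.gen / (S₁.gen ^ 2 - S₁.σ S₁.gen ^ 2) +
        S₁.σ S₁.gen / (S₁.gen ^ 2 - S₁.σ S₁.gen ^ 2) := by
      rw [← add_div, eq_div_iff hg]; field_simp; ring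
    rw [hinv, ← neg_sub (S₁.gen ^ 2) (S₁.σ S₁.gen ^ 2), div_neg, div_neg]
    simp only [TensorProduct.neg_tmul, TensorProduct.tmul_sub, TensorProduct.add_tmul]
    abel
  obtain ⟨t, ht'⟩ := S₁.fixed ((S₁.gen - S₁.σ S₁.gen) ^ 2) (by
    rw [map_pow, map_sub, S₁.σ_σ]; ring)
  change ((S₁.gen₀ - S₁.fixedEquiv S₁ S₁.gen₀ : S₁.fixedSub S₁) : K₁ ⊗[F] K₁) *
    ((S₁.gen₀ - S₁.fixedEquiv S₁ S₁.gen₀ : S₁.fixedSub S₁) : K₁ ⊗[F] K₁) = 1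
  rw [key, Algebra.TensorProduct.tmul_mul_tmul, ← pow_two, ← pow_two, ← ht',
    Algebra.algebraMap_eq_smul_one, TensorProduct.tmul_smul, TensorProduct.smul_tmul',
    Algebra.smul_def, ht', ← mul_pow, mul_inv_cancel₀ hd, one_pow]
  rfl

theorem isIntegral_quad₀_gen_sub (hζ : IsIntegral R S₁.gen) (hu : S₁.GenUnit)
    (hu' : IsIntegral R ((S₁.gen - S₁.σ S₁.gen) * (S₁.gen + S₁.σ S₁.gen))⁻¹) :
    IsIntegral R ((quad₀ hu).gen - (quad₀ hu).σ (quad₀ hu).gen) :=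
  (isIntegral_quad₀_gen hζ hu hu').sub
    ((quad₀ hu).isIntegral_σ (isIntegral_quad₀_gen hζ hu hu'))

/-- The coordinates of an integral element of `K₁ ⊗ K₂` are integral. -/
theorem isIntegral_of_tensor_span (hζ : IsIntegral R S₁.gen) (hu : S₁.GenUnit)
    (hu' : IsIntegral R ((S₁.gen - S₁.σ S₁.gen) * (S₁.gen + S₁.σ S₁.gen))⁻¹) {y y' : K₂}
    (hx : IsIntegral R ((1 : K₁) ⊗ₜ[F] y + S₁.gen ⊗ₜ y')) :
    IsIntegral R y ∧ IsIntegral R y' := by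
  have hd := gen_sub_ne_zero hu
  have hdi := isIntegral_inv_gen_sub hζ hu hu'
  have hσ := S₁.isIntegral_σ hζ
  -- Applying `σ₁ ⊗ 1` gives a second linear equation for `y` and `y'`; the determinant is `ζ₁ - σ
  -- ζ₁` up to sign, an integral unit.
  have hx' : IsIntegral R ((1 : K₁) ⊗ₜ[F] y + S₁.σ S₁.gen ⊗ₜ y') := by
    have := hx.map ((S₁.leftHom (K₂ := K₂)).restrictScalars R)
    change IsIntegral R (S₁.leftHom ((1 : K₁) ⊗ₜ[F] y + S₁.gen ⊗ₜ y')) at this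
    rwa [map_add, leftHom, Algebra.TensorProduct.map_tmul, Algebra.TensorProduct.map_tmul,
      map_one] at this
  have hinj : Function.Injective
      ((Algebra.TensorProduct.includeRight : K₂ →ₐ[F] K₁ ⊗[F] K₂).restrictScalars R) :=
    Algebra.TensorProduct.includeRight_injective (A := K₁) (B := K₂) (algebraMap F K₁).injective
  have h1 : IsIntegral R (1 : K₂) := isIntegral_one
  rw [← isIntegral_algHom_iff _ hinj, ← isIntegral_algHom_iff _ hinj]
  change IsIntegral R ((1 : K₁) ⊗ₜ[F] y) ∧ IsIntegral R ((1 : K₁) ⊗ₜ[F] y')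
  constructor
  · have e : (1 : K₁) ⊗ₜ[F] y = ((S₁.gen - S₁.σ S₁.gen)⁻¹ ⊗ₜ[F] (1 : K₂)) *
        ((S₁.gen ⊗ₜ[F] 1) * ((1 : K₁) ⊗ₜ[F] y + S₁.σ S₁.gen ⊗ₜ y') -
          (S₁.σ S₁.gen ⊗ₜ[F] 1) * ((1 : K₁) ⊗ₜ[F] y + S₁.gen ⊗ₜ y')) := by
      simp only [mul_add, Algebra.TensorProduct.tmul_mul_tmul, one_mul, mul_one]
      rw [mul_comm (S₁.σ S₁.gen), add_sub_add_right_eq_sub, ← TensorProduct.sub_tmul,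
        Algebra.TensorProduct.tmul_mul_tmul, inv_mul_cancel₀ hd, one_mul]
    rw [e]
    exact (isIntegral_tmul hdi h1).mul (((isIntegral_tmul hζ h1).mul hx').sub
      ((isIntegral_tmul hσ h1).mul hx))
  · have e : (1 : K₁) ⊗ₜ[F] y' = ((S₁.gen - S₁.σ S₁.gen)⁻¹ ⊗ₜ[F] (1 : K₂)) *
        (((1 : K₁) ⊗ₜ[F] y + S₁.gen ⊗ₜ y') - ((1 : K₁) ⊗ₜ[F] y + S₁.σ S₁.gen ⊗ₜ y')) := by
      rw [add_sub_add_left_eq_sub, ← TensorProduct.sub_tmul,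
        Algebra.TensorProduct.tmul_mul_tmul, inv_mul_cancel₀ hd, one_mul]
    rw [e]
    exact (isIntegral_tmul hdi h1).mul (hx.sub hx')

theorem isIntegral_quad₃_gen (hζ : IsIntegral R S₁.gen) (hu : S₁.GenUnit)
    (hϖ : IsIntegral R S₂.gen) : IsIntegral R (quad₃ S₂ hu).gen := by
  rw [isIntegral_fixedSub_iff]
  exact (isIntegral_tmul hζ hϖ).add (isIntegral_tmul (S₁.isIntegral_σ hζ) (S₂.isIntegral_σ hϖ))

/-- The ring of integers of `K₃` is generated by `ϖ₃`. -/
theorem adjoin_quad₃_gen [IsIntegrallyClosed R] [IsDomain R] [IsFractionRing R F]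
    (hζ : IsIntegral R S₁.gen) (hu : S₁.GenUnit)
    (hu' : IsIntegral R ((S₁.gen - S₁.σ S₁.gen) * (S₁.gen + S₁.σ S₁.gen))⁻¹)
    (hϖ : Algebra.adjoin R {S₂.gen} = integralClosure R K₂) :
    Algebra.adjoin R {(quad₃ S₂ hu).gen} = integralClosure R (S₁.fixedSub S₂) := by
  have hϖi := isIntegral_of_adjoin_eq_integralClosure hϖ
  refine le_antisymm (Algebra.adjoin_le (Set.singleton_subset_iff.2
    (isIntegral_quad₃_gen S₂ hζ hu hϖi))) fun x hx => ?_
  have hd := gen_sub_ne_zero hu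
  have ht := gen_add_ne_zero hu
  have hdi := isIntegral_inv_gen_sub hζ hu hu'
  have hti := isIntegral_inv_gen_add hζ hu hu'
  have hσ := S₁.isIntegral_σ hζ
  obtain ⟨t, ht'⟩ := S₂.exists_trace S₂.gen
  obtain ⟨n, hn'⟩ := S₂.exists_norm S₂.gen
  obtain ⟨t, rfl⟩ := exists_algebraMap_eq_of_isIntegral (F := F) (ht' ▸ hϖi.add (S₂.isIntegral_σ hϖi))
  obtain ⟨n, rfl⟩ := exists_algebraMap_eq_of_isIntegral (F := F) (hn' ▸ hϖi.mul (S₂.isIntegral_σ hϖi))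
  rw [← IsScalarTower.algebraMap_apply] at ht' hn'
  have hquad : S₂.gen * S₂.gen = t • S₂.gen - n • 1 := by
    rw [← Algebra.algebraMap_eq_smul_one, Algebra.smul_def, ht', hn']; ring
  have coords (y : K₂) (hy : IsIntegral R y) : ∃ r s : R, y = r • 1 + s • S₂.gen :=
    exists_eq_add_smul_of_mem_adjoin hquad (hϖ ▸ hy)
  obtain ⟨x, hxm⟩ := x
  have hx0 : IsIntegral R x := isIntegral_fixedSub_iff.1 hx
  have hx2 : Algebra.TensorProduct.map (S₁.σ : K₁ →ₐ[F] K₁) (S₂.σ : K₂ →ₐ[F] K₂) x = x := hxm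
  set g₃ : K₁ ⊗[F] K₂ := S₁.gen ⊗ₜ S₂.gen + S₁.σ S₁.gen ⊗ₜ S₂.σ S₂.gen with hg₃
  have hg₃fix : Algebra.TensorProduct.map (S₁.σ : K₁ →ₐ[F] K₁) (S₂.σ : K₂ →ₐ[F] K₂) g₃ = g₃ :=
    (S₁.gen₃ S₂).2
  set T := S₁.gen + S₁.σ S₁.gen with hT
  have hTσ : S₁.σ T = T := by rw [hT, map_add, S₁.σ_σ, add_comm]
  -- Eliminating `σ ϖ₂` by its trace shows that, over `O_{K₁}`, `g₃` is a unit multiple of `1 ⊗ ϖ₂`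
  -- plus a constant, so it can replace `1 ⊗ ϖ₂` as a generator.
  have hg₃' : g₃ = (S₁.gen - S₁.σ S₁.gen) ⊗ₜ S₂.gen + (t • S₁.σ S₁.gen) ⊗ₜ (1 : K₂) := by
    have : S₂.σ S₂.gen = t • 1 - S₂.gen := by
      rw [← Algebra.algebraMap_eq_smul_one, ht']; ring
    rw [hg₃, this, TensorProduct.tmul_sub, TensorProduct.sub_tmul, TensorProduct.smul_tmul]
    abel
  have hone : (1 : K₁) ⊗ₜ[F] S₂.gen = ((S₁.gen - S₁.σ S₁.gen)⁻¹ ⊗ₜ 1) *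
      (g₃ - (t • S₁.σ S₁.gen) ⊗ₜ (1 : K₂)) := by
    rw [hg₃', add_sub_cancel_right, Algebra.TensorProduct.tmul_mul_tmul, inv_mul_cancel₀ hd,
      one_mul]
  -- `x = c + c' g₃` with `c` and `c'` integral over `O_F`
  obtain ⟨c, c', hci, hci', hc⟩ : ∃ c c' : K₁, IsIntegral R c ∧ IsIntegral R c' ∧
      x = c ⊗ₜ 1 + (c' ⊗ₜ 1) * g₃ := by
    obtain ⟨y, y', rfl⟩ := S₁.tensor_span x
    obtain ⟨hy, hy'⟩ := isIntegral_of_tensor_span hζ hu hu' hx0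
    obtain ⟨r, s, rfl⟩ := coords y hy
    obtain ⟨r', s', rfl⟩ := coords y' hy'
    have hint (r s : R) : IsIntegral R (r • (1 : K₁) + s • S₁.gen) :=
      (isIntegral_one.smul r).add (hζ.smul s)
    refine ⟨(r • 1 + r' • S₁.gen) - (s • 1 + s' • S₁.gen) * (S₁.gen - S₁.σ S₁.gen)⁻¹ *
      (t • S₁.σ S₁.gen), (s • 1 + s' • S₁.gen) * (S₁.gen - S₁.σ S₁.gen)⁻¹,
      (hint _ _).sub (((hint _ _).mul hdi).mul (hσ.smul t)), (hint _ _).mul hdi, ?_⟩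
    have e1 : (1 : K₁) ⊗ₜ[F] (r • 1 + s • S₂.gen) + S₁.gen ⊗ₜ (r' • 1 + s' • S₂.gen) =
        (r • 1 + r' • S₁.gen) ⊗ₜ 1 + ((s • 1 + s' • S₁.gen) ⊗ₜ 1) * ((1 : K₁) ⊗ₜ[F] S₂.gen) := by
      rw [Algebra.TensorProduct.tmul_mul_tmul, mul_one, one_mul]
      simp only [TensorProduct.tmul_add, TensorProduct.add_tmul, TensorProduct.smul_tmul]
      abel
    rw [e1, hone, ← mul_assoc, mul_sub, Algebra.TensorProduct.tmul_mul_tmul,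
      Algebra.TensorProduct.tmul_mul_tmul, mul_one, mul_one, TensorProduct.sub_tmul]
    abel
  have trace_mem (c : K₁) (hc : IsIntegral R c) :
      ∃ r : R, algebraMap R K₁ r = S₁.gen / T * c + S₁.σ (S₁.gen / T * c) := by
    obtain ⟨f, hf⟩ := S₁.exists_trace (S₁.gen / T * c)
    have h1 : IsIntegral R (S₁.gen / T * c) := by
      rw [div_eq_mul_inv]; exact (hζ.mul hti).mul hc
    obtain ⟨r, rfl⟩ := exists_algebraMap_eq_of_isIntegral (F := F) (hf ▸ h1.add (S₁.isIntegral_σ h1))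
    exact ⟨r, by rw [← hf, ← IsScalarTower.algebraMap_apply]⟩
  obtain ⟨r, hr⟩ := trace_mem c hci
  obtain ⟨s, hs⟩ := trace_mem c' hci'
  have hx3 : x = (S₁.σ c) ⊗ₜ 1 + (S₁.σ c' ⊗ₜ 1) * g₃ := by
    rw [← hx2, hc, map_add, map_mul, hg₃fix]; simp
  have hsum : (1 : K₁ ⊗[F] K₂) = (S₁.gen / T) ⊗ₜ 1 + (S₁.σ (S₁.gen / T)) ⊗ₜ 1 := by
    rw [← TensorProduct.add_tmul, map_div₀, hTσ, ← add_div, ← hT, div_self ht]; rfl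
  have e1 : algebraMap R (K₁ ⊗[F] K₂) r = (S₁.gen / T * c) ⊗ₜ 1 +
      (S₁.σ (S₁.gen / T) * S₁.σ c) ⊗ₜ 1 := by
    rw [← map_mul, ← TensorProduct.add_tmul, ← hr]; rfl
  have e2 : s • g₃ = ((S₁.gen / T * c') ⊗ₜ 1 +
      (S₁.σ (S₁.gen / T) * S₁.σ c') ⊗ₜ 1) * g₃ := by
    rw [← map_mul, ← TensorProduct.add_tmul, ← hs, Algebra.smul_def]; rfl
  have hfin : x = algebraMap R (K₁ ⊗[F] K₂) r + s • g₃ := by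
    -- Both `x` and `g₃` are fixed by `σ₁ ⊗ σ₂`, so `x` has a second expression with conjugate
    -- coefficients. Combining the two with the integral weights `ζ₁ / T` and `σ(ζ₁ / T)`, whose sum
    -- is `1`, turns the coefficients into traces in `R`; no division by `2` is needed.
    calc x = ((S₁.gen / T) ⊗ₜ 1) * x + ((S₁.σ (S₁.gen / T)) ⊗ₜ 1) * x := by
          rw [← add_mul, ← hsum, one_mul]
      _ = ((S₁.gen / T) ⊗ₜ 1) * (c ⊗ₜ 1 + (c' ⊗ₜ 1) * g₃) +
          ((S₁.σ (S₁.gen / T)) ⊗ₜ 1) * ((S₁.σ c) ⊗ₜ 1 + (S₁.σ c' ⊗ₜ 1) * g₃) := by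
          rw [← hc, ← hx3]
      _ = _ := by
          rw [e1, e2]
          simp only [mul_add, add_mul, ← mul_assoc, Algebra.TensorProduct.tmul_mul_tmul, mul_one]
          abel
  have hsub : (⟨x, hxm⟩ : S₁.fixedSub S₂) =
      algebraMap R (S₁.fixedSub S₂) r + s • (quad₃ S₂ hu).gen := Subtype.ext hfin
  rw [hsub]
  exact add_mem (algebraMap_mem _ _)
    (Subalgebra.smul_mem _ (Algebra.self_mem_adjoin_singleton R _) _)

end QuadAlg

/-! ### The theorem for `(K₀, K₃)` and `(K₁, K₂)` -/

theorem theorem5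
    (F : Type*) [Field F] [ValuativeRel F] [TopologicalSpace F] [IsNonarchimedeanLocalField F]
    (K₁ K₂ : Type*) [Field K₁] [Field K₂] [Algebra F K₁] [Algebra F K₂]
    (hd₁ : Module.finrank F K₁ = 2) (hd₂ : Module.finrank F K₂ = 2)
    (hur : Algebra.FormallyUnramified 𝒪[F] (integralClosure 𝒪[F] K₁))
    -- the involutions and the generators `ζ₁` of `K₁` and `ϖ₂` of `K₂`
    (S₁ : QuadAlg F K₁) (S₂ : QuadAlg F K₂)
    -- `ζ₁ ∈ O_{K₁}` and `(ζ₁ - σ ζ₁)(ζ₁ + σ ζ₁) ∈ O_{K₁}ˣ`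
    (hζ : IsIntegral 𝒪[F] S₁.gen) (hu : S₁.GenUnit)
    (hu' : IsIntegral 𝒪[F] ((S₁.gen - S₁.σ S₁.gen) * (S₁.gen + S₁.σ S₁.gen))⁻¹)
    -- `O_{K₂} = O_F[ϖ₂]`
    (hϖ : Algebra.adjoin 𝒪[F] {S₂.gen} = integralClosure 𝒪[F] K₂)
    (h : ℕ) :
    (∀ (β : QuadPair (QuadAlg.quad₀ hu) (QuadAlg.quad₃ S₂ hu)
          (Module.End F (Fin (2 * h) → F))),
      β.IsRegularSemisimple h → β.IsMaximal 𝒪[F] →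
      ∀ (hz : QuadPair.IsMaximalOrderUnit 𝒪[F] (1 - β.z)) (s : ℂ),
        β.orbTwisted 𝒪[F] (Nat.card 𝓀[F]) s =
          β.orbTwistedReduced 𝒪[F] (QuadAlg.quad₀_genUnit hu)
            (β.isUnit_one_add_z (QuadAlg.quad₀_genUnit hu) hz) (Nat.card 𝓀[F]) s) ∧
    (∀ (α : QuadPair S₁ S₂ (Module.End F (Fin (2 * h) → F))),
      α.IsRegularSemisimple h → α.IsMaximal 𝒪[F] →
      ∀ (hz : QuadPair.IsMaximalOrderUnit 𝒪[F] (1 - α.z)),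
        α.orb 𝒪[F] = α.orbReduced 𝒪[F] hu (α.isUnit_one_add_z hu hz)) := by
  refine ⟨fun β _ hmax hz s => ?_, fun α _ hmax hz => ?_⟩
  · exact QuadPair.orbTwisted_eq_orbTwistedReduced (QuadAlg.quad₀_genUnit hu) _ hmax hz
      (QuadAlg.isIntegral_quad₀_gen hζ hu hu')
      ⟨_, QuadAlg.quad₀_gen_sub_mul_self hu, QuadAlg.isIntegral_quad₀_gen_sub hζ hu hu'⟩
      (QuadAlg.adjoin_quad₃_gen S₂ hζ hu hu' hϖ) _ s
  · exact QuadPair.orb_eq_orbReduced hu _ hmax hz hζ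
      ⟨_, mul_inv_cancel₀ (QuadAlg.gen_sub_ne_zero hu),
        QuadAlg.isIntegral_inv_gen_sub hζ hu hu'⟩ hϖ
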